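/- An MV-algebra $(A,\oplus,{}^*,0)$ is an abelian monoid $(A,\oplus,0)$ with a unary operation ${}^*$ such that $x^{**}=x$, $0^*\oplus x=0^*$ and $(x^*\oplus y)^*\oplus y=(y^*\oplus x)^*\oplus x$; put $1=0^*$, $x\odot y=(x^*\oplus y^*)^*$, $d(x,y)=(x\odot y^*)\oplus(x^*\odot y)$, and $x\le y$ iff $x^*\oplus y=1$. An ideal is a subset that contains $0$, is downward closed and is closed under $\oplus$; $(S]$ denotes the ideal generated by $S$, and $A/J$ is the quotient by the congruence $d(x,y)\in J$. An MV-algebra is semisimple if it is a subdirect product of MV-subalgebras of the standard MV-algebra $[0,1]$, where $x\oplus y=\min(1,x+y)$ and $x^*=1-x$. Let $P$ be $[0,1]$ or $[0,1]\cap\mathbb Q$. A Riesz MV-algebra (for $P=[0,1]$), or a DMV-algebra (for $P=[0,1]\cap\mathbb Q$), is an MV-algebra with a scalar multiplication by elements of $P$ such that $r(x\odot y^*)=(rx)\odot(ry)^*$, $(r\odot q^*)x=(rx)\odot(qx)^*$, $r(qx)=(rq)x$ and $1x=x$; its ideals are those of its MV-algebra reduct, and $r[x]=[rx]$ in its quotients.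 An MV-algebra (Riesz MV-algebra, DMV-algebra) is finitely presented if it is isomorphic to the quotient of a free MV-algebra (free Riesz MV-algebra, free DMV-algebra) on finitely many generators by a principal ideal. $MV_n$ is the free MV-algebra on $n$ generators. A bimorphism $\beta:A\times B\to C$ of MV-algebras is a map with $\beta(1,1)=1$ that in each argument, with the other one fixed, preserves $0$, $\vee$ and $\wedge$ and sends elements with $x\odot y=0$ to elements with the same property, with $x\oplus y$ going to the $\oplus$-sum of the images. The semisimple tensor product $A\otimes B$ is the semisimple MV-algebra, generated by elements $a\otimes b$, such that $(a,b)\mapsto a\otimes b$ is universal among bimorphisms of $A\times B$ into semisimple MV-algebras. The MV-algebra $P\otimes A$ is a Riesz MV-algebra (resp. DMV-algebra) with $r(s\otimes a)=(rs)\otimes a$. Let $\iota:MV_n\to P\otimes MV_n$, $\iota(f)=1\otimes f$. **Theorem.** Let $A$ be a finitely presented MV-algebra and let $P$ be $[0,1]$ or $[0,1]\cap\mathbb Q$. 1. For every $n$ and every ideal $J$ of $MV_n$ with $A\cong MV_n/J$ there is an isomorphism of MV-algebras $$P\otimes(MV_n/J)\;\cong\;(P\otimes MV_n)/(\iota(J)],\qquad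 \alpha\otimes[f]\mapsto[\alpha\otimes f]\quad(\alpha\in P,\ f\in MV_n),$$ and it is also an isomorphism of Riesz MV-algebras (if $P=[0,1]$) or DMV-algebras (if $P=[0,1]\cap\mathbb Q$). 2. Consequently $[0,1]\otimes A$ is a finitely presented Riesz MV-algebra and $([0,1]\cap\mathbb Q)\otimes A$ is a finitely presented DMV-algebra; that is, the tensor functors $A\mapsto[0,1]\otimes A$ and $A\mapsto([0,1]\cap\mathbb Q)\otimes A$ send finitely presented MV-algebras to finitely presented Riesz MV-algebras and finitely presented DMV-algebras, respectively. -/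

import Mathlib

universe u v w

noncomputable section

/-! ## MV-algebras -/

/-- MV-algebras. The operation `⊕` is written `+`, the involution `x*` is written `xᶜ`, and the
unit `1 = 0*` is `0ᶜ`. The multiple `n x = x ⊕ ⋯ ⊕ x` is `n • x`. -/
class MVAlgebra (A : Type u) extends AddCommMonoid A, Compl A where
  compl_compl' : ∀ x : A, xᶜᶜ = x
  compl_zero_add : ∀ x : A, (0 : A)ᶜ + x = (0 : A)ᶜ
  luk : ∀ x y : A, (xᶜ + y)ᶜ + y = (yᶜ + x)ᶜ + x

namespace MVAlgebra

variable {A : Type u} [MVAlgebra A]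

/-- `x ⊙ y = (x* ⊕ y*)*`. -/
def odot (x y : A) : A := (xᶜ + yᶜ)ᶜ

/-- Chang's distance `d(x, y) = (x ⊙ y*) ⊕ (x* ⊙ y)`. -/
def chang (x y : A) : A := odot x yᶜ + odot xᶜ y

/-- `x ∨ y = x ⊕ (y ⊙ x*)`. -/
def join (x y : A) : A := x + odot y xᶜ

/-- `x ∧ y = (x* ∨ y*)*`. -/
def meet (x y : A) : A := (join xᶜ yᶜ)ᶜ

/-- The natural order: `x ≤ y` iff `x* ⊕ y = 1`. -/
def Le (x y : A) : Prop := xᶜ + y = (0 : A)ᶜ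

theorem add_compl_self (x : A) : xᶜ + x = (0 : A)ᶜ := by
  have h := luk x (0 : A)ᶜ
  rw [add_comm xᶜ, compl_zero_add, compl_compl', zero_add, zero_add] at h
  exact h.symm

theorem le_iff_exists {x y : A} : Le x y ↔ ∃ z, y = x + z := by
  constructor
  · intro h
    refine ⟨(yᶜ + x)ᶜ, ?_⟩
    have h' := luk x y
    rw [show xᶜ + y = (0 : A)ᶜ from h, compl_compl', zero_add] at h'
    rw [add_comm]; exact h'
  · rintro ⟨z, rfl⟩
    rw [Le, ← add_assoc, add_compl_self, compl_zero_add]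

theorem Le.refl (x : A) : Le x x := add_compl_self x

theorem Le.trans {x y z : A} (h : Le x y) (h' : Le y z) : Le x z := by
  obtain ⟨a, rfl⟩ := le_iff_exists.1 h
  obtain ⟨b, rfl⟩ := le_iff_exists.1 h'
  exact le_iff_exists.2 ⟨a + b, add_assoc _ _ _⟩

theorem Le.add {x y x' y' : A} (h : Le x y) (h' : Le x' y') : Le (x + x') (y + y') := by
  obtain ⟨a, rfl⟩ := le_iff_exists.1 h
  obtain ⟨b, rfl⟩ := le_iff_exists.1 h'
  exact le_iff_exists.2 ⟨a + b, add_add_add_comm _ _ _ _⟩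

theorem le_add_right (x y : A) : Le x (x + y) := le_iff_exists.2 ⟨y, rfl⟩

theorem le_add_left (x y : A) : Le y (x + y) := le_iff_exists.2 ⟨x, add_comm _ _⟩

theorem odot_compl_le {x y z : A} : Le (odot x yᶜ) z ↔ Le x (y + z) := by
  simp only [Le, odot, compl_compl', add_assoc]

theorem le_add_odot (x y : A) : Le x (y + odot x yᶜ) := odot_compl_le.1 (Le.refl _)

theorem odot_comm (x y : A) : odot x y = odot y x := by rw [odot, odot, add_comm]

end MVAlgebra

open MVAlgebra

/-- Homomorphisms of MV-algebras. -/
structure MVHom (A : Type u) (B : Type v) [MVAlgebra A] [MVAlgebra B] extends A →+ B where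
  map_compl' : ∀ x, toFun xᶜ = (toFun x)ᶜ

instance {A : Type u} {B : Type v} [MVAlgebra A] [MVAlgebra B] :
    CoeFun (MVHom A B) (fun _ => A → B) := ⟨fun f => f.toFun⟩

/-- Isomorphisms of MV-algebras. -/
structure MVEquiv (A : Type u) (B : Type v) [MVAlgebra A] [MVAlgebra B] extends A ≃+ B where
  map_compl' : ∀ x, toFun xᶜ = (toFun x)ᶜ

instance {A : Type u} {B : Type v} [MVAlgebra A] [MVAlgebra B] :
    CoeFun (MVEquiv A B) (fun _ => A → B) := ⟨fun f => f.toFun⟩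

/-- The MV-algebra of functions with pointwise operations. -/
instance {ι : Type v} {A : Type u} [MVAlgebra A] : MVAlgebra (ι → A) where
  compl_compl' f := funext fun i => compl_compl' (f i)
  compl_zero_add f := funext fun i => compl_zero_add (f i)
  luk f g := funext fun i => luk (f i) (g i)

/-! ## Ideals and quotients -/

/-- Ideals of an MV-algebra. -/
structure MVIdeal (A : Type u) [MVAlgebra A] where
  carrier : Set A
  zero_mem : (0 : A) ∈ carrier
  add_mem : ∀ {x y : A}, x ∈ carrier → y ∈ carrier → x + y ∈ carrier
  lower : ∀ {x y : A}, Le x y → y ∈ carrier → x ∈ carrier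

namespace MVIdeal

variable {A : Type u} [MVAlgebra A]

/-- The ideal `(S]` generated by a set `S`. -/
def span (S : Set A) : MVIdeal A where
  carrier := {x | ∀ I : MVIdeal A, S ⊆ I.carrier → x ∈ I.carrier}
  zero_mem I _ := I.zero_mem
  add_mem hx hy I hI := I.add_mem (hx I hI) (hy I hI)
  lower h hy I hI := I.lower h (hy I hI)

theorem chang_mem_iff (J : MVIdeal A) (x y : A) :
    chang x y ∈ J.carrier ↔ odot x yᶜ ∈ J.carrier ∧ odot y xᶜ ∈ J.carrier := by
  rw [chang, odot_comm xᶜ y]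
  exact ⟨fun h => ⟨J.lower (le_add_right _ _) h, J.lower (le_add_left _ _) h⟩,
    fun h => J.add_mem h.1 h.2⟩

theorem odot_trans (J : MVIdeal A) {x y z : A} (h : odot x yᶜ ∈ J.carrier)
    (h' : odot y zᶜ ∈ J.carrier) : odot x zᶜ ∈ J.carrier := by
  refine J.lower (odot_compl_le.2 ?_) (J.add_mem h' h)
  rw [← add_assoc]
  exact (le_add_odot x y).trans ((le_add_odot y z).add (Le.refl _))

theorem odot_add (J : MVIdeal A) {x y x' y' : A} (h : odot x yᶜ ∈ J.carrier)
    (h' : odot x' y'ᶜ ∈ J.carrier) : odot (x + x') (y + y')ᶜ ∈ J.carrier := by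
  refine J.lower (odot_compl_le.2 ?_) (J.add_mem h h')
  rw [add_add_add_comm]
  exact (le_add_odot x y).add (le_add_odot x' y')

/-- The congruence of an ideal: `x ∼ y` iff `d(x, y) ∈ J`. -/
def setoid (J : MVIdeal A) : Setoid A where
  r x y := chang x y ∈ J.carrier
  iseqv :=
    { refl := fun x => by
        have h : odot x xᶜ = 0 := by rw [odot, compl_compl', add_compl_self, compl_compl']
        rw [chang_mem_iff, h]; exact ⟨J.zero_mem, J.zero_mem⟩
      symm := fun h => by
        rw [chang_mem_iff] at *; exact h.symm
      trans := fun h h' => by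
        rw [chang_mem_iff] at *
        exact ⟨J.odot_trans h.1 h'.1, J.odot_trans h'.2 h.2⟩ }

/-- The quotient `A / J`. -/
def Quotient (J : MVIdeal A) : Type u := _root_.Quotient J.setoid

/-- The canonical map `A → A / J`. -/
def cls (J : MVIdeal A) (x : A) : J.Quotient := _root_.Quotient.mk J.setoid x

theorem cls_eq (J : MVIdeal A) {x y : A} : J.cls x = J.cls y ↔ chang x y ∈ J.carrier :=
  ⟨fun h => _root_.Quotient.exact h, fun h => _root_.Quotient.sound h⟩

instance (J : MVIdeal A) : Zero J.Quotient := ⟨J.cls 0⟩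

instance (J : MVIdeal A) : Add J.Quotient where
  add := Quotient.map₂ (· + ·) fun _ _ h _ _ h' => by
    have h := (J.chang_mem_iff _ _).1 h
    have h' := (J.chang_mem_iff _ _).1 h'
    exact (J.chang_mem_iff _ _).2 ⟨J.odot_add h.1 h'.1, J.odot_add h.2 h'.2⟩

instance (J : MVIdeal A) : MVAlgebra J.Quotient where
  compl := Quotient.map (fun x => xᶜ) fun x y h => by
    have h := (J.chang_mem_iff _ _).1 h
    refine (J.chang_mem_iff _ _).2 ?_
    rw [compl_compl', compl_compl', odot_comm xᶜ, odot_comm yᶜ]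
    exact ⟨h.2, h.1⟩
  nsmul := nsmulRec
  add_assoc := by
    rintro ⟨x⟩ ⟨y⟩ ⟨z⟩; exact congrArg J.cls (add_assoc x y z)
  zero_add := by rintro ⟨x⟩; exact congrArg J.cls (zero_add x)
  add_zero := by rintro ⟨x⟩; exact congrArg J.cls (add_zero x)
  add_comm := by rintro ⟨x⟩ ⟨y⟩; exact congrArg J.cls (add_comm x y)
  compl_compl' := by rintro ⟨x⟩; exact congrArg J.cls (compl_compl' x)
  compl_zero_add := by rintro ⟨x⟩; exact congrArg J.cls (compl_zero_add x)
  luk := by rintro ⟨x⟩ ⟨y⟩; exact congrArg J.cls (luk x y)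

end MVIdeal

/-! ## The standard algebras `[0,1]` and `[0,1] ∩ ℚ` -/

/-- The set `[0,1] ∩ K` for a subfield `K` of `ℝ`. -/
def UnitPart (K : Subfield ℝ) : Type := {x : ℝ // x ∈ K ∧ 0 ≤ x ∧ x ≤ 1}

/-- The field of rational numbers as a subfield of `ℝ`. -/
def rationalSubfield : Subfield ℝ := (algebraMap ℚ ℝ).fieldRange

/-- The real unit interval `[0,1]`. -/
abbrev RealUnit : Type := UnitPart ⊤

/-- The rational unit interval `[0,1] ∩ ℚ`. -/
abbrev RatUnit : Type := UnitPart rationalSubfield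

namespace UnitPart

variable {K : Subfield ℝ}

@[ext] theorem ext {x y : UnitPart K} (h : x.1 = y.1) : x = y := Subtype.ext h

instance : One (UnitPart K) := ⟨⟨1, K.one_mem, zero_le_one, le_rfl⟩⟩

instance : Mul (UnitPart K) :=
  ⟨fun x y => ⟨x.1 * y.1, K.mul_mem x.2.1 y.2.1, mul_nonneg x.2.2.1 y.2.2.1,
    mul_le_one₀ x.2.2.2 y.2.2.1 y.2.2.2⟩⟩

/-- `x ⊕ y = min(1, x + y)`. -/
instance : Add (UnitPart K) where
  add x y := ⟨min 1 (x.1 + y.1), by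
    rcases min_choice 1 (x.1 + y.1) with h | h <;> rw [h]
    exacts [K.one_mem, K.add_mem x.2.1 y.2.1],
    le_min zero_le_one (add_nonneg x.2.2.1 y.2.2.1), min_le_left _ _⟩

instance : Zero (UnitPart K) := ⟨⟨0, K.zero_mem, le_rfl, zero_le_one⟩⟩

/-- The standard MV-algebra structure, `x* = 1 - x`. -/
instance : MVAlgebra (UnitPart K) where
  compl x := ⟨1 - x.1, K.sub_mem K.one_mem x.2.1, sub_nonneg.2 x.2.2.2,
    sub_le_self _ x.2.2.1⟩
  nsmul := nsmulRec
  add_assoc := by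
    rintro ⟨x, _, hx, hx'⟩ ⟨y, _, hy, hy'⟩ ⟨z, _, hz, hz'⟩
    apply Subtype.ext
    change min 1 (min 1 (x + y) + z) = min 1 (x + min 1 (y + z))
    grind
  zero_add := by
    rintro ⟨x, _, hx, hx'⟩
    apply Subtype.ext
    change min 1 (0 + x) = x
    grind
  add_zero := by
    rintro ⟨x, _, hx, hx'⟩
    apply Subtype.ext
    change min 1 (x + 0) = x
    grind
  add_comm := by
    rintro ⟨x, _, hx, hx'⟩ ⟨y, _, hy, hy'⟩
    apply Subtype.ext
    change min 1 (x + y) = min 1 (y + x)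
    rw [_root_.add_comm]
  compl_compl' := by
    rintro ⟨x, _, hx, hx'⟩
    apply Subtype.ext
    change 1 - (1 - x) = x
    ring
  compl_zero_add := by
    rintro ⟨x, _, hx, hx'⟩
    apply Subtype.ext
    change min 1 ((1 - 0) + x) = 1 - 0
    grind
  luk := by
    rintro ⟨x, _, hx, hx'⟩ ⟨y, _, hy, hy'⟩
    apply Subtype.ext
    change min 1 (1 - min 1 (1 - x + y) + y) = min 1 (1 - min 1 (1 - y + x) + x)
    grind

theorem val_zero : (0 : UnitPart K).1 = 0 := rfl
theorem val_one : (1 : UnitPart K).1 = 1 := rfl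
theorem val_mul (x y : UnitPart K) : (x * y).1 = x.1 * y.1 := rfl
theorem val_add (x y : UnitPart K) : (x + y).1 = min 1 (x.1 + y.1) := rfl
theorem val_compl (x : UnitPart K) : (xᶜ).1 = 1 - x.1 := rfl
theorem val_odot (x y : UnitPart K) : (odot x y).1 = max 0 (x.1 + y.1 - 1) := by
  have hx := x.2.2.2
  have hy := y.2.2.2
  simp only [odot, val_compl, val_add]
  grind

end UnitPart

/-! ## Riesz MV-algebras and DMV-algebras -/

/-- The scalar multiplication by elements of `[0,1] ∩ K` on an MV-algebra. For `K = ℝ` this is a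
Riesz MV-algebra, for `K = ℚ` a DMV-algebra. -/
class ScalarMVAlgebra (K : Subfield ℝ) (A : Type u) [MVAlgebra A] extends
    SMul (UnitPart K) A where
  smul_odot_compl : ∀ (r : UnitPart K) (x y : A), r • odot x yᶜ = odot (r • x) (r • y)ᶜ
  odot_compl_smul : ∀ (r q : UnitPart K) (x : A), odot r qᶜ • x = odot (r • x) (q • x)ᶜ
  smul_smul' : ∀ (r q : UnitPart K) (x : A), r • q • x = (r * q) • x
  one_smul' : ∀ x : A, (1 : UnitPart K) • x = x

/-- Riesz MV-algebras. -/
abbrev RieszMVAlgebra (A : Type u) [MVAlgebra A] := ScalarMVAlgebra ⊤ A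

/-- DMV-algebras. -/
abbrev DMVAlgebra (A : Type u) [MVAlgebra A] := ScalarMVAlgebra rationalSubfield A

namespace ScalarMVAlgebra

theorem smul_le {K : Subfield ℝ} {A : Type u} [MVAlgebra A] [ScalarMVAlgebra K A]
    (r : UnitPart K) (x : A) : Le (r • x) x := by
  have h0 : ∀ y : A, odot y yᶜ = 0 := fun y => by
    rw [odot, compl_compl', add_compl_self, compl_compl']
  have h1 : odot r (1 : UnitPart K)ᶜ = odot r rᶜ := by
    apply UnitPart.ext
    have := r.2.2.2
    rw [UnitPart.val_odot, UnitPart.val_odot, UnitPart.val_compl, UnitPart.val_compl,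
      UnitPart.val_one]
    grind
  have h2 : odot (r • x) xᶜ = 0 := by
    have := odot_compl_smul r 1 x
    rw [h1, odot_compl_smul, h0, one_smul'] at this
    exact this.symm
  rw [← add_zero x, ← odot_compl_le, add_zero, h2]
  exact Le.refl _

end ScalarMVAlgebra

open ScalarMVAlgebra

/-- Ideals of a Riesz MV-algebra (or of a DMV-algebra) are the ideals of the MV-algebra reduct; the
quotient carries the scalar multiplication `r [x] = [r x]`. -/
instance {K : Subfield ℝ} {A : Type u} [MVAlgebra A] [ScalarMVAlgebra K A] (J : MVIdeal A) :
    ScalarMVAlgebra K J.Quotient where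
  smul r := Quotient.map (fun x => r • x) fun x y h => by
    have h := (J.chang_mem_iff _ _).1 h
    refine (J.chang_mem_iff _ _).2 ?_
    rw [← smul_odot_compl, ← smul_odot_compl]
    exact ⟨J.lower (smul_le _ _) h.1, J.lower (smul_le _ _) h.2⟩
  smul_odot_compl := by
    rintro r ⟨x⟩ ⟨y⟩; exact congrArg J.cls (smul_odot_compl r x y)
  odot_compl_smul := by
    rintro r q ⟨x⟩; exact congrArg J.cls (odot_compl_smul r q x)
  smul_smul' := by rintro r q ⟨x⟩; exact congrArg J.cls (smul_smul' r q x)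
  one_smul' := by rintro ⟨x⟩; exact congrArg J.cls (one_smul' (K := K) x)

/-! ## Free algebras -/

/-- Terms in the language of MV-algebras, with variables in `X`. -/
inductive MVTerm (X : Type u) : Type u
  | var : X → MVTerm X
  | zero : MVTerm X
  | oplus : MVTerm X → MVTerm X → MVTerm X
  | neg : MVTerm X → MVTerm X

namespace MVTerm

/-- The congruence on terms generated by the identities that define MV-algebras. -/
inductive Rel (X : Type u) : MVTerm X → MVTerm X → Prop
  | refl (a) : Rel X a a
  | symm {a b} : Rel X a b → Rel X b a
  | trans {a b c} : Rel X a b → Rel X b c → Rel X a c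
  | oplus_congr {a b a' b'} : Rel X a b → Rel X a' b' → Rel X (oplus a a') (oplus b b')
  | neg_congr {a b} : Rel X a b → Rel X (neg a) (neg b)
  | assoc (a b c) : Rel X (oplus (oplus a b) c) (oplus a (oplus b c))
  | comm (a b) : Rel X (oplus a b) (oplus b a)
  | zero_oplus (a) : Rel X (oplus zero a) a
  | neg_neg (a) : Rel X (neg (neg a)) a
  | one_oplus (a) : Rel X (oplus (neg zero) a) (neg zero)
  | luk (a b) : Rel X (oplus (neg (oplus (neg a) b)) b) (oplus (neg (oplus (neg b) a)) a)

/-- Provable equality of terms. -/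
def setoid (X : Type u) : Setoid (MVTerm X) :=
  ⟨Rel X, Rel.refl, Rel.symm, Rel.trans⟩

/-- The value of a term under an assignment of the variables. -/
def eval {X : Type u} {A : Type v} [MVAlgebra A] (f : X → A) : MVTerm X → A
  | var x => f x
  | zero => 0
  | oplus a b => eval f a + eval f b
  | neg a => (eval f a)ᶜ

theorem eval_eq {X : Type u} {A : Type v} [MVAlgebra A] (f : X → A) {a b : MVTerm X}
    (h : Rel X a b) : eval f a = eval f b := by
  induction h with
  | refl => rfl
  | symm _ ih => exact ih.symm
  | trans _ _ ih ih' => exact ih.trans ih'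
  | oplus_congr _ _ ih ih' => simp only [eval, ih, ih']
  | neg_congr _ ih => simp only [eval, ih]
  | assoc => simp only [eval, add_assoc]
  | comm => simp only [eval]; exact add_comm _ _
  | zero_oplus => simp only [eval, zero_add]
  | neg_neg => simp only [eval, compl_compl']
  | one_oplus => simp only [eval, compl_zero_add]
  | luk => simp only [eval]; exact luk _ _

end MVTerm

/-- The free MV-algebra over the set `X`. -/
def FreeMV (X : Type u) : Type u := Quotient (MVTerm.setoid X)

namespace FreeMV

variable {X : Type u}

instance : Add (FreeMV X) where
  add := Quotient.map₂ MVTerm.oplus fun _ _ h _ _ h' => MVTerm.Rel.oplus_congr h h'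

instance : Zero (FreeMV X) := ⟨Quotient.mk _ MVTerm.zero⟩

instance : MVAlgebra (FreeMV X) where
  compl := Quotient.map MVTerm.neg fun _ _ h => MVTerm.Rel.neg_congr h
  nsmul := nsmulRec
  add_assoc := by rintro ⟨a⟩ ⟨b⟩ ⟨c⟩; exact Quotient.sound (.assoc a b c)
  zero_add := by rintro ⟨a⟩; exact Quotient.sound (.zero_oplus a)
  add_zero := by
    rintro ⟨a⟩; exact Quotient.sound ((MVTerm.Rel.comm _ _).trans (.zero_oplus a))
  add_comm := by rintro ⟨a⟩ ⟨b⟩; exact Quotient.sound (.comm a b)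
  compl_compl' := by rintro ⟨a⟩; exact Quotient.sound (.neg_neg a)
  compl_zero_add := by rintro ⟨a⟩; exact Quotient.sound (.one_oplus a)
  luk := by rintro ⟨a⟩ ⟨b⟩; exact Quotient.sound (.luk a b)

/-- The free generators. -/
def of (x : X) : FreeMV X := Quotient.mk _ (MVTerm.var x)

/-- The universal property of the free MV-algebra. -/
theorem existsUnique_hom {A : Type v} [MVAlgebra A] (f : X → A) :
    ∃! φ : MVHom (FreeMV X) A, ∀ x, φ (of x) = f x := by
  refine ⟨⟨⟨⟨Quotient.lift (MVTerm.eval f) fun _ _ h => MVTerm.eval_eq f h, rfl⟩, ?_⟩, ?_⟩,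
    fun _ => rfl, ?_⟩
  · rintro ⟨a⟩ ⟨b⟩; rfl
  · rintro ⟨a⟩; rfl
  · intro ψ hψ
    have key : ∀ a : MVTerm X, ψ (Quotient.mk _ a) = MVTerm.eval f a := by
      intro a
      induction a with
      | var x => exact hψ x
      | zero => exact ψ.map_zero'
      | oplus a b iha ihb => exact (ψ.map_add' _ _).trans (congrArg₂ (· + ·) iha ihb)
      | neg a ih => exact (ψ.map_compl' _).trans (congrArg (fun z => zᶜ) ih)
    obtain ⟨ψ, hc⟩ := ψ
    congr 1
    ext ⟨a⟩
    exact key a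

end FreeMV

/-- Terms in the language of MV-algebras with scalar multiplication by `[0,1] ∩ K`. -/
inductive ScalarMVTerm (K : Subfield ℝ) (X : Type u) : Type u
  | var : X → ScalarMVTerm K X
  | zero : ScalarMVTerm K X
  | oplus : ScalarMVTerm K X → ScalarMVTerm K X → ScalarMVTerm K X
  | neg : ScalarMVTerm K X → ScalarMVTerm K X
  | scale : UnitPart K → ScalarMVTerm K X → ScalarMVTerm K X

namespace ScalarMVTerm

/-- The congruence on terms generated by the defining identities. -/
inductive Rel (K : Subfield ℝ) (X : Type u) : ScalarMVTerm K X → ScalarMVTerm K X → Prop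
  | refl (a) : Rel K X a a
  | symm {a b} : Rel K X a b → Rel K X b a
  | trans {a b c} : Rel K X a b → Rel K X b c → Rel K X a c
  | oplus_congr {a b a' b'} : Rel K X a b → Rel K X a' b' → Rel K X (oplus a a') (oplus b b')
  | neg_congr {a b} : Rel K X a b → Rel K X (neg a) (neg b)
  | scale_congr (r) {a b} : Rel K X a b → Rel K X (scale r a) (scale r b)
  | assoc (a b c) : Rel K X (oplus (oplus a b) c) (oplus a (oplus b c))
  | comm (a b) : Rel K X (oplus a b) (oplus b a)
  | zero_oplus (a) : Rel K X (oplus zero a) a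
  | neg_neg (a) : Rel K X (neg (neg a)) a
  | one_oplus (a) : Rel K X (oplus (neg zero) a) (neg zero)
  | luk (a b) : Rel K X (oplus (neg (oplus (neg a) b)) b) (oplus (neg (oplus (neg b) a)) a)
  | scale_odot (r a b) : Rel K X (scale r (neg (oplus (neg a) (neg (neg b)))))
      (neg (oplus (neg (scale r a)) (neg (neg (scale r b)))))
  | odot_scale (r q a) : Rel K X (scale (odot r qᶜ) a)
      (neg (oplus (neg (scale r a)) (neg (neg (scale q a)))))
  | scale_scale (r q a) : Rel K X (scale r (scale q a)) (scale (r * q) a)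
  | one_scale (a) : Rel K X (scale 1 a) a

/-- Provable equality of terms. -/
def setoid (K : Subfield ℝ) (X : Type u) : Setoid (ScalarMVTerm K X) :=
  ⟨Rel K X, Rel.refl, Rel.symm, Rel.trans⟩

/-- The value of a term under an assignment of the variables. -/
def eval {K : Subfield ℝ} {X : Type u} {A : Type v} [MVAlgebra A] [ScalarMVAlgebra K A]
    (f : X → A) : ScalarMVTerm K X → A
  | var x => f x
  | zero => 0
  | oplus a b => eval f a + eval f b
  | neg a => (eval f a)ᶜ
  | scale r a => r • eval f a

theorem eval_eq {K : Subfield ℝ} {X : Type u} {A : Type v} [MVAlgebra A] [ScalarMVAlgebra K A]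
    (f : X → A) {a b : ScalarMVTerm K X} (h : Rel K X a b) : eval f a = eval f b := by
  induction h with
  | refl => rfl
  | symm _ ih => exact ih.symm
  | trans _ _ ih ih' => exact ih.trans ih'
  | oplus_congr _ _ ih ih' => simp only [eval, ih, ih']
  | neg_congr _ ih => simp only [eval, ih]
  | scale_congr _ _ ih => simp only [eval, ih]
  | assoc => simp only [eval, add_assoc]
  | comm => simp only [eval]; exact add_comm _ _
  | zero_oplus => simp only [eval, zero_add]
  | neg_neg => simp only [eval, compl_compl']
  | one_oplus => simp only [eval, compl_zero_add]
  | luk => simp only [eval]; exact luk _ _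
  | scale_odot => simp only [eval]; exact smul_odot_compl _ _ _
  | odot_scale => simp only [eval]; exact odot_compl_smul _ _ _
  | scale_scale => simp only [eval]; exact smul_smul' _ _ _
  | one_scale => simp only [eval]; exact one_smul' _

end ScalarMVTerm

/-- The free Riesz MV-algebra (`K = ℝ`), or the free DMV-algebra (`K = ℚ`), over the set `X`. -/
def FreeScalarMV (K : Subfield ℝ) (X : Type u) : Type u := Quotient (ScalarMVTerm.setoid K X)

namespace FreeScalarMV

variable {K : Subfield ℝ} {X : Type u}

instance : Add (FreeScalarMV K X) where
  add := Quotient.map₂ ScalarMVTerm.oplus fun _ _ h _ _ h' => ScalarMVTerm.Rel.oplus_congr h h'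

instance : Zero (FreeScalarMV K X) := ⟨Quotient.mk _ ScalarMVTerm.zero⟩

instance : MVAlgebra (FreeScalarMV K X) where
  compl := Quotient.map ScalarMVTerm.neg fun _ _ h => ScalarMVTerm.Rel.neg_congr h
  nsmul := nsmulRec
  add_assoc := by rintro ⟨a⟩ ⟨b⟩ ⟨c⟩; exact Quotient.sound (.assoc a b c)
  zero_add := by rintro ⟨a⟩; exact Quotient.sound (.zero_oplus a)
  add_zero := by
    rintro ⟨a⟩; exact Quotient.sound ((ScalarMVTerm.Rel.comm _ _).trans (.zero_oplus a))
  add_comm := by rintro ⟨a⟩ ⟨b⟩; exact Quotient.sound (.comm a b)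
  compl_compl' := by rintro ⟨a⟩; exact Quotient.sound (.neg_neg a)
  compl_zero_add := by rintro ⟨a⟩; exact Quotient.sound (.one_oplus a)
  luk := by rintro ⟨a⟩ ⟨b⟩; exact Quotient.sound (.luk a b)

instance : ScalarMVAlgebra K (FreeScalarMV K X) where
  smul r := Quotient.map (ScalarMVTerm.scale r) fun _ _ h => ScalarMVTerm.Rel.scale_congr r h
  smul_odot_compl := by rintro r ⟨a⟩ ⟨b⟩; exact Quotient.sound (.scale_odot r a b)
  odot_compl_smul := by rintro r q ⟨a⟩; exact Quotient.sound (.odot_scale r q a)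
  smul_smul' := by rintro r q ⟨a⟩; exact Quotient.sound (.scale_scale r q a)
  one_smul' := by rintro ⟨a⟩; exact Quotient.sound (.one_scale a)

/-- The free generators. -/
def of (x : X) : FreeScalarMV K X := Quotient.mk _ (ScalarMVTerm.var x)

/-- The universal property of the free Riesz MV-algebra (free DMV-algebra). -/
theorem existsUnique_hom {A : Type v} [MVAlgebra A] [ScalarMVAlgebra K A] (f : X → A) :
    ∃! φ : MVHom (FreeScalarMV K X) A,
      (∀ (r : UnitPart K) x, φ (r • x) = r • φ x) ∧ ∀ x, φ (of x) = f x := by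
  refine ⟨⟨⟨⟨Quotient.lift (ScalarMVTerm.eval f) fun _ _ h => ScalarMVTerm.eval_eq f h, rfl⟩,
    ?_⟩, ?_⟩, ⟨?_, fun _ => rfl⟩, ?_⟩
  · rintro ⟨a⟩ ⟨b⟩; rfl
  · rintro ⟨a⟩; rfl
  · rintro r ⟨a⟩; rfl
  · intro ψ hψ
    have key : ∀ a : ScalarMVTerm K X, ψ (Quotient.mk _ a) = ScalarMVTerm.eval f a := by
      intro a
      induction a with
      | var x => exact hψ.2 x
      | zero => exact ψ.map_zero'
      | oplus a b iha ihb => exact (ψ.map_add' _ _).trans (congrArg₂ (· + ·) iha ihb)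
      | neg a ih => exact (ψ.map_compl' _).trans (congrArg (fun z => zᶜ) ih)
      | scale r a ih => exact (hψ.1 r _).trans (congrArg (fun z => r • z) ih)
    obtain ⟨ψ, hc⟩ := ψ
    congr 1
    ext ⟨a⟩
    exact key a

end FreeScalarMV

/-- `MV_n`, the free MV-algebra over `n` generators. -/
abbrev MVn (n : ℕ) : Type := FreeMV (Fin n)

/-- A finitely presented MV-algebra is a quotient of a free finitely generated MV-algebra by a
principal ideal (up to isomorphism). -/
def MVAlgebra.IsFinitelyPresented (A : Type u) [MVAlgebra A] : Prop :=
  ∃ (n : ℕ) (a : MVn n), Nonempty (MVEquiv A (MVIdeal.span {a}).Quotient)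

/-- A finitely presented Riesz MV-algebra (`K = ℝ`), or DMV-algebra (`K = ℚ`), is a quotient of a
free finitely generated one by a principal ideal (up to an isomorphism that preserves the scalar
multiplication). -/
def ScalarMVAlgebra.IsFinitelyPresented (K : Subfield ℝ) (A : Type u) [MVAlgebra A]
    [ScalarMVAlgebra K A] : Prop :=
  ∃ (n : ℕ) (a : FreeScalarMV K (Fin n)) (e : MVEquiv A (MVIdeal.span {a}).Quotient),
    ∀ (r : UnitPart K) (x : A), e (r • x) = r • e x

/-! ## Bimorphisms and the semisimple tensor product -/

/-- A semisimple MV-algebra is a subdirect product of MV-subalgebras of `[0,1]`: the homomorphisms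
into `[0,1]` separate its points. -/
def MVAlgebra.IsSemisimple (A : Type u) [MVAlgebra A] : Prop :=
  ∀ x y : A, (∀ f : MVHom A RealUnit, f x = f y) → x = y

/-- Bimorphisms of MV-algebras `A × B → C`. -/
structure MVBimorphism (A : Type u) (B : Type v) (C : Type w) [MVAlgebra A] [MVAlgebra B]
    [MVAlgebra C] where
  toFun : A → B → C
  map_one_one : toFun (0 : A)ᶜ (0 : B)ᶜ = (0 : C)ᶜ
  map_zero_left : ∀ b, toFun 0 b = 0
  map_zero_right : ∀ a, toFun a 0 = 0
  map_join_left : ∀ a a' b, toFun (join a a') b = join (toFun a b) (toFun a' b)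
  map_join_right : ∀ a b b', toFun a (join b b') = join (toFun a b) (toFun a b')
  map_meet_left : ∀ a a' b, toFun (meet a a') b = meet (toFun a b) (toFun a' b)
  map_meet_right : ∀ a b b', toFun a (meet b b') = meet (toFun a b) (toFun a b')
  odot_left : ∀ a a' b, odot a a' = 0 → odot (toFun a b) (toFun a' b) = 0
  odot_right : ∀ a b b', odot b b' = 0 → odot (toFun a b) (toFun a b') = 0
  map_add_left : ∀ a a' b, odot a a' = 0 → toFun (a + a') b = toFun a b + toFun a' b
  map_add_right : ∀ a b b', odot b b' = 0 → toFun a (b + b') = toFun a b + toFun a b'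

instance {A : Type u} {B : Type v} {C : Type w} [MVAlgebra A] [MVAlgebra B] [MVAlgebra C] :
    CoeFun (MVBimorphism A B C) (fun _ => A → B → C) := ⟨fun f => f.toFun⟩

namespace MVHom

variable {A : Type u} {B : Type v} [MVAlgebra A] [MVAlgebra B] (f : MVHom A B)

theorem apply_zero : f 0 = 0 := f.map_zero'
theorem apply_add (x y : A) : f (x + y) = f x + f y := f.map_add' x y
theorem apply_compl (x : A) : f xᶜ = (f x)ᶜ := f.map_compl' x
theorem apply_odot (x y : A) : f (odot x y) = odot (f x) (f y) := by
  simp only [odot, apply_add, apply_compl]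
theorem apply_join (x y : A) : f (join x y) = join (f x) (f y) := by
  simp only [join, apply_add, apply_compl, apply_odot]
theorem apply_meet (x y : A) : f (meet x y) = meet (f x) (f y) := by
  simp only [meet, apply_join, apply_compl]

/-- Composition of a bimorphism with a homomorphism. -/
def compBimorphism {D : Type w} [MVAlgebra D] (f : MVHom B D) {A' : Type*} [MVAlgebra A']
    (β : MVBimorphism A A' B) : MVBimorphism A A' D where
  toFun a b := f (β a b)
  map_one_one := by rw [β.map_one_one, f.apply_compl, f.apply_zero]
  map_zero_left b := by rw [β.map_zero_left, f.apply_zero]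
  map_zero_right a := by rw [β.map_zero_right, f.apply_zero]
  map_join_left a a' b := by rw [β.map_join_left, f.apply_join]
  map_join_right a b b' := by rw [β.map_join_right, f.apply_join]
  map_meet_left a a' b := by rw [β.map_meet_left, f.apply_meet]
  map_meet_right a b b' := by rw [β.map_meet_right, f.apply_meet]
  odot_left a a' b h := by rw [← f.apply_odot, β.odot_left a a' b h, f.apply_zero]
  odot_right a b b' h := by rw [← f.apply_odot, β.odot_right a b b' h, f.apply_zero]
  map_add_left a a' b h := by rw [β.map_add_left a a' b h, f.apply_add]
  map_add_right a b b' h := by rw [β.map_add_right a b b' h, f.apply_add]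

end MVHom

section Tensor

variable (A : Type u) (B : Type v) [MVAlgebra A] [MVAlgebra B]

/-- The subalgebra of `[0,1]`-valued functions on the set of bimorphisms `A × B → [0,1]` generated by
the evaluations `β ↦ β(a, b)`. -/
inductive InTensor : (MVBimorphism A B RealUnit → RealUnit) → Prop
  | tmul (a : A) (b : B) : InTensor fun β => β a b
  | zero : InTensor 0
  | oplus {s t} : InTensor s → InTensor t → InTensor (s + t)
  | neg {t} : InTensor t → InTensor tᶜ

/-- The underlying additive submonoid of the semisimple tensor product. -/
def tensorSubmonoid : AddSubmonoid (MVBimorphism A B RealUnit → RealUnit) where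
  carrier := {t | InTensor A B t}
  zero_mem' := .zero
  add_mem' := .oplus

/-- The semisimple tensor product `A ⊗ B`: the semisimple MV-algebra that is generated by the
elements `a ⊗ b` and universal for bimorphisms of `A × B` into semisimple MV-algebras (see
`SemisimpleTensor.isSemisimple` and `SemisimpleTensor.existsUnique_hom`). -/
def SemisimpleTensor : Type (max u v) := tensorSubmonoid A B

end Tensor

namespace SemisimpleTensor

variable {A : Type u} {B : Type v} [MVAlgebra A] [MVAlgebra B]

instance : AddCommMonoid (SemisimpleTensor A B) :=
  inferInstanceAs (AddCommMonoid (tensorSubmonoid A B))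

instance : MVAlgebra (SemisimpleTensor A B) where
  compl t := ⟨(t.1)ᶜ, .neg t.2⟩
  compl_compl' t := Subtype.ext (compl_compl' t.1)
  compl_zero_add t := Subtype.ext (compl_zero_add t.1)
  luk s t := Subtype.ext (luk s.1 t.1)

/-- The element `a ⊗ b`. -/
def tmul (a : A) (b : B) : SemisimpleTensor A B := ⟨fun β => β a b, .tmul a b⟩

/-- The canonical map `ι : B → A ⊗ B`, `ι(b) = 1 ⊗ b`. -/
def incl (b : B) : SemisimpleTensor A B := tmul (0 : A)ᶜ b

/-- Evaluation of an element of the tensor product at a bimorphism. -/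
def evalHom (β : MVBimorphism A B RealUnit) : MVHom (SemisimpleTensor A B) RealUnit where
  toFun t := t.1 β
  map_zero' := rfl
  map_add' _ _ := rfl
  map_compl' _ := rfl

theorem evalHom_tmul (β : MVBimorphism A B RealUnit) (a : A) (b : B) :
    evalHom β (tmul a b) = β a b := rfl

theorem ext_evalHom {s t : SemisimpleTensor A B} (h : ∀ β, evalHom β s = evalHom β t) : s = t :=
  Subtype.ext (funext h)

theorem isSemisimple : MVAlgebra.IsSemisimple (SemisimpleTensor A B) :=
  fun _ _ h => ext_evalHom fun β => h (evalHom β)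

/-- The canonical map `(a, b) ↦ a ⊗ b` is a bimorphism. -/
def bimorphism : MVBimorphism A B (SemisimpleTensor A B) where
  toFun := tmul
  map_one_one := ext_evalHom fun β => by
    rw [MVHom.apply_compl, MVHom.apply_zero]; exact β.map_one_one
  map_zero_left b := ext_evalHom fun β => by
    rw [MVHom.apply_zero]; exact β.map_zero_left b
  map_zero_right a := ext_evalHom fun β => by
    rw [MVHom.apply_zero]; exact β.map_zero_right a
  map_join_left a a' b := ext_evalHom fun β => by
    rw [MVHom.apply_join]; exact β.map_join_left a a' b
  map_join_right a b b' := ext_evalHom fun β => by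
    rw [MVHom.apply_join]; exact β.map_join_right a b b'
  map_meet_left a a' b := ext_evalHom fun β => by
    rw [MVHom.apply_meet]; exact β.map_meet_left a a' b
  map_meet_right a b b' := ext_evalHom fun β => by
    rw [MVHom.apply_meet]; exact β.map_meet_right a b b'
  odot_left a a' b h := ext_evalHom fun β => by
    rw [MVHom.apply_odot, MVHom.apply_zero]; exact β.odot_left a a' b h
  odot_right a b b' h := ext_evalHom fun β => by
    rw [MVHom.apply_odot, MVHom.apply_zero]; exact β.odot_right a b b' h
  map_add_left a a' b h := ext_evalHom fun β => by
    rw [MVHom.apply_add]; exact β.map_add_left a a' b h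
  map_add_right a b b' h := ext_evalHom fun β => by
    rw [MVHom.apply_add]; exact β.map_add_right a b b' h

theorem induction {p : SemisimpleTensor A B → Prop} (tm : ∀ a b, p (tmul a b)) (zero : p 0)
    (oplus : ∀ s t, p s → p t → p (s + t)) (neg : ∀ t, p t → p tᶜ) (t) : p t := by
  suffices H : ∀ t (h : InTensor A B t), p ⟨t, h⟩ from H t.1 t.2
  intro t h
  induction h with
  | tmul a b => exact tm a b
  | zero => exact zero
  | oplus hs ht ihs iht => exact oplus ⟨_, hs⟩ ⟨_, ht⟩ ihs iht
  | neg h ih => exact neg ⟨_, h⟩ ih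

/-- The universal property of the semisimple tensor product. -/
theorem existsUnique_hom {C : Type w} [MVAlgebra C] (hC : MVAlgebra.IsSemisimple C)
    (β : MVBimorphism A B C) :
    ∃! φ : MVHom (SemisimpleTensor A B) C, ∀ a b, φ (tmul a b) = β a b := by
  have ex : ∀ t : SemisimpleTensor A B,
      ∃ c : C, ∀ f : MVHom C RealUnit, f c = evalHom (f.compBimorphism β) t := by
    intro t
    induction t using induction with
    | tm a b => exact ⟨β a b, fun _ => rfl⟩
    | zero => exact ⟨0, fun f => by rw [f.apply_zero, MVHom.apply_zero]⟩
    | oplus s t hs ht =>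
      obtain ⟨c, hc⟩ := hs
      obtain ⟨d, hd⟩ := ht
      exact ⟨c + d, fun f => by rw [f.apply_add, MVHom.apply_add, hc, hd]⟩
    | neg t ht =>
      obtain ⟨c, hc⟩ := ht
      exact ⟨cᶜ, fun f => by rw [f.apply_compl, MVHom.apply_compl, hc]⟩
  choose φ hφ using ex
  refine ⟨⟨⟨⟨φ, ?_⟩, ?_⟩, ?_⟩, ?_, ?_⟩
  · exact hC _ _ fun f => by rw [hφ, f.apply_zero, MVHom.apply_zero]
  · intro s t
    exact hC _ _ fun f => by
      rw [f.apply_add]; simp only [hφ, MVHom.apply_add]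
  · intro t
    exact hC _ _ fun f => by
      rw [f.apply_compl]; simp only [hφ, MVHom.apply_compl]
  · intro a b
    exact hC _ _ fun f => hφ _ f
  · intro ψ hψ
    have key : ∀ t, ψ t = φ t := by
      intro t
      refine hC _ _ fun f => ?_
      rw [hφ]
      induction t using induction with
      | tm a b => rw [hψ]; rfl
      | zero => rw [ψ.apply_zero, f.apply_zero, MVHom.apply_zero]
      | oplus s t hs ht => rw [ψ.apply_add, f.apply_add, MVHom.apply_add, hs, ht]
      | neg t ht => rw [ψ.apply_compl, f.apply_compl, MVHom.apply_compl, ht]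
    obtain ⟨ψ, hc⟩ := ψ
    congr 1
    ext t
    exact key t

end SemisimpleTensor

/-! ## The scalar multiplication on `([0,1] ∩ K) ⊗ A` -/

section

variable {K : Subfield ℝ} {A : Type u} [MVAlgebra A]

theorem MVBimorphism.val_add_left (β : MVBimorphism (UnitPart K) A RealUnit) (x y : UnitPart K)
    (a : A) (h : x.1 + y.1 ≤ 1) : (β (x + y) a).1 = (β x a).1 + (β y a).1 := by
  have h0 : odot x y = 0 := by
    apply UnitPart.ext
    rw [UnitPart.val_odot, UnitPart.val_zero]
    exact max_eq_left (by linarith)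
  have h1 := congrArg Subtype.val (β.odot_left x y a h0)
  have h2 := congrArg Subtype.val (β.map_add_left x y a h0)
  rw [UnitPart.val_odot] at h1
  change _ = (0 : ℝ) at h1
  have h3 : (β x a).1 + (β y a).1 - 1 ≤ 0 := (le_max_right _ _).trans h1.le
  rw [UnitPart.val_add] at h2
  rw [h2]
  exact min_eq_right (by linarith)

/-- An additive function on `[0,1] ∩ K` with nonnegative values is linear. -/
theorem UnitPart.linear_of_additive (g : UnitPart K → ℝ) (hg : ∀ x, 0 ≤ g x)
    (ha : ∀ x y : UnitPart K, x.1 + y.1 ≤ 1 → g (x + y) = g x + g y) (x : UnitPart K) :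
    g x = x.1 * g 1 := by
  have key : ∀ (n : ℕ) (s : UnitPart K), n * s.1 ≤ 1 →
      (n • s).1 = n * s.1 ∧ g (n • s) = n * g s := by
    intro n s
    induction n with
    | zero =>
      intro _
      have h0 := ha 0 0 (by simp [UnitPart.val_zero])
      rw [add_zero] at h0
      rw [zero_smul]
      refine ⟨by simp [UnitPart.val_zero], ?_⟩
      push_cast
      linarith
    | succ n ih =>
      intro h
      push_cast at h
      obtain ⟨h1, h2⟩ := ih (by nlinarith [s.2.2.1])
      have h3 : (n • s).1 + s.1 ≤ 1 := by rw [h1]; linarith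
      rw [succ_nsmul]
      refine ⟨?_, ?_⟩
      · rw [UnitPart.val_add, min_eq_right h3, h1]; push_cast; ring
      · rw [ha _ _ h3, h2]; push_cast; ring
  have mono : ∀ s t : UnitPart K, s.1 ≤ t.1 → g s ≤ g t := by
    intro s t h
    let d : UnitPart K := ⟨t.1 - s.1, K.sub_mem t.2.1 s.2.1, sub_nonneg.2 h, by
      linarith [s.2.2.1, t.2.2.2]⟩
    have hd : s + d = t := by
      apply UnitPart.ext
      rw [UnitPart.val_add]
      change min 1 (s.1 + (t.1 - s.1)) = t.1
      rw [add_sub_cancel]; exact min_eq_right t.2.2.2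
    have := ha s d (by change s.1 + (t.1 - s.1) ≤ 1; linarith [t.2.2.2])
    rw [hd] at this
    linarith [hg d]
  have bound : ∀ n : ℕ, 0 < n → |g x - x.1 * g 1| * n ≤ g 1 := by
    intro n hn
    have hn' : (0 : ℝ) < n := Nat.cast_pos.2 hn
    let u : UnitPart K := ⟨(n : ℝ)⁻¹, K.inv_mem (natCast_mem K n), by positivity,
      inv_le_one_of_one_le₀ (by exact_mod_cast hn)⟩
    have hu : (n : ℝ) * u.1 = 1 := mul_inv_cancel₀ hn'.ne'
    have hgu : g 1 = n * g u := by
      obtain ⟨h1, h2⟩ := key n u hu.le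
      rw [← h2]; congr 1; apply UnitPart.ext; rw [h1, hu]; rfl
    let m := ⌊x.1 * n⌋₊
    have hm : (m : ℝ) ≤ x.1 * n := Nat.floor_le (mul_nonneg x.2.2.1 hn'.le)
    have hm' : x.1 * n < m + 1 := Nat.lt_floor_add_one _
    have hmu : (m : ℝ) * u.1 ≤ x.1 := by
      have : (m : ℝ) * u.1 ≤ x.1 * n * u.1 := mul_le_mul_of_nonneg_right hm u.2.2.1
      rwa [mul_assoc, hu, mul_one] at this
    have hmu' : x.1 ≤ m * u.1 + u.1 := by
      have : x.1 * n * u.1 ≤ (m + 1) * u.1 := mul_le_mul_of_nonneg_right hm'.le u.2.2.1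
      rw [mul_assoc, hu] at this; linarith
    obtain ⟨h1, h2⟩ := key m u (hmu.trans x.2.2.2)
    let d : UnitPart K := ⟨x.1 - m * u.1,
      K.sub_mem x.2.1 (K.mul_mem (natCast_mem K m) u.2.1), sub_nonneg.2 hmu, by
        linarith [u.2.2.2]⟩
    have hd : m • u + d = x := by
      apply UnitPart.ext
      rw [UnitPart.val_add, h1]
      change min 1 (m * u.1 + (x.1 - m * u.1)) = x.1
      rw [add_sub_cancel]; exact min_eq_right x.2.2.2
    have hgx := ha (m • u) d (by
      rw [h1]; change m * u.1 + (x.1 - m * u.1) ≤ 1; linarith [x.2.2.2])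
    rw [hd, h2] at hgx
    have hdu : g d ≤ g u := mono d u (by change x.1 - m * u.1 ≤ u.1; linarith)
    have hd0 := hg d
    have hu0 := hg u
    have hb1 := mul_le_mul_of_nonneg_right hm hu0
    have hb2 := mul_le_mul_of_nonneg_right hm'.le hu0
    have hb : |g x - x.1 * g 1| ≤ g u := by
      rw [hgu, hgx, abs_le]
      constructor <;> linarith
    rw [mul_comm, hgu]
    rw [hgu] at hb
    exact mul_le_mul_of_nonneg_left hb hn'.le
  have h0 : |g x - x.1 * g 1| ≤ 0 := by
    by_contra! hc
    obtain ⟨n, hn⟩ := exists_nat_gt (g 1 / |g x - x.1 * g 1|)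
    have hn0 : 0 < n := by
      have : (0 : ℝ) < n := lt_of_le_of_lt (div_nonneg (hg 1) hc.le) hn
      exact_mod_cast this
    have h2 := bound n hn0
    rw [div_lt_iff₀ hc] at hn
    linarith
  linarith [abs_eq_zero.1 (le_antisymm h0 (abs_nonneg _))]

theorem MVBimorphism.val_mul_left (β : MVBimorphism (UnitPart K) A RealUnit) (r s : UnitPart K)
    (a : A) : (β (r * s) a).1 = r.1 * (β s a).1 := by
  have lin : ∀ r : UnitPart K, (β r a).1 = r.1 * (β 1 a).1 :=
    UnitPart.linear_of_additive (fun r => (β r a).1) (fun r => (β r a).2.2.1)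
      (fun x y h => β.val_add_left x y a h)
  rw [lin (r * s), lin s, UnitPart.val_mul, mul_assoc]

/-- The product of a scalar in `[0,1] ∩ K` and a number in `[0,1]`. -/
def UnitPart.scale (r : UnitPart K) (x : RealUnit) : RealUnit :=
  ⟨r.1 * x.1, Subfield.mem_top _, mul_nonneg r.2.2.1 x.2.2.1,
    mul_le_one₀ r.2.2.2 x.2.2.1 x.2.2.2⟩

theorem InTensor.scale (r : UnitPart K) {t : MVBimorphism (UnitPart K) A RealUnit → RealUnit}
    (h : InTensor (UnitPart K) A t) :
    InTensor (UnitPart K) A fun β => r.scale (t β) := by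
  have hc : InTensor (UnitPart K) A fun _ => r.scale 1 := by
    convert InTensor.tmul (B := A) r (0 : A)ᶜ using 1
    funext β
    apply UnitPart.ext
    have h1 := β.val_mul_left r 1 (0 : A)ᶜ
    have h2 := congrArg Subtype.val β.map_one_one
    have h3 : r * 1 = r := UnitPart.ext (mul_one _)
    have h4 : (1 : UnitPart K) = (0 : UnitPart K)ᶜ := UnitPart.ext (sub_zero _).symm
    rw [h3] at h1
    rw [h1, h4, h2]
    change r.1 * 1 = r.1 * (1 - 0)
    rw [sub_zero]
  induction h with
  | tmul s a =>
    convert InTensor.tmul (B := A) (r * s) a using 1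
    funext β
    exact UnitPart.ext (β.val_mul_left r s a).symm
  | zero =>
    convert InTensor.zero (A := UnitPart K) (B := A) using 1
    funext β
    exact UnitPart.ext (mul_zero r.1)
  | @neg t _ ih =>
    -- `r (1 - t) = (r t ⊕ (r 1)*)*`
    convert InTensor.neg (.oplus ih (.neg hc)) using 1
    funext β
    apply UnitPart.ext
    change r.1 * (1 - (t β).1) = 1 - min 1 (r.1 * (t β).1 + (1 - r.1 * 1))
    have := mul_le_mul_of_nonneg_left (t β).2.2.2 r.2.2.1
    rw [min_eq_right (by linarith)]
    ring
  | @oplus s t _ _ ihs iht =>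
    -- `r (s ⊕ t) = r 1 ∧ (r s ⊕ r t)`
    convert InTensor.neg (.oplus (.neg hc) (.neg (.oplus (.neg hc) (.oplus ihs iht)))) using 1
    funext β
    apply UnitPart.ext
    change r.1 * min 1 ((s β).1 + (t β).1) =
      1 - min 1 ((1 - r.1 * 1) +
        (1 - min 1 ((1 - r.1 * 1) + min 1 (r.1 * (s β).1 + r.1 * (t β).1))))
    have h1 := r.2.2.1
    have h2 := r.2.2.2
    have h3 := mul_nonneg h1 (s β).2.2.1
    have h4 := mul_nonneg h1 (t β).2.2.1
    rw [mul_min_of_nonneg _ _ h1, mul_add]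
    grind

/-- The Riesz MV-algebra `𝒯_⊗(A) = [0,1] ⊗ A` (`K = ℝ`) and the DMV-algebra
`𝒟_⊗(A) = ([0,1] ∩ ℚ) ⊗ A` (`K = ℚ`): the scalar multiplication is computed pointwise, and
`r (s ⊗ a) = (r s) ⊗ a`. -/
instance : ScalarMVAlgebra K (SemisimpleTensor (UnitPart K) A) where
  smul r t := ⟨fun β => r.scale (t.1 β), .scale r t.2⟩
  smul_odot_compl r x y := Subtype.ext <| funext fun β => UnitPart.ext <| by
    change r.1 * (odot (x.1 β) (y.1 β)ᶜ).1 = (odot (r.scale (x.1 β)) (r.scale (y.1 β))ᶜ).1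
    rw [UnitPart.val_odot, UnitPart.val_odot, UnitPart.val_compl, UnitPart.val_compl,
      mul_max_of_nonneg _ _ r.2.2.1]
    change _ = max 0 (r.1 * (x.1 β).1 + (1 - r.1 * (y.1 β).1) - 1)
    ring_nf
  odot_compl_smul r q x := Subtype.ext <| funext fun β => UnitPart.ext <| by
    change (odot r qᶜ).1 * (x.1 β).1 = (odot (r.scale (x.1 β)) (q.scale (x.1 β))ᶜ).1
    rw [UnitPart.val_odot, UnitPart.val_odot, UnitPart.val_compl, UnitPart.val_compl,
      max_mul_of_nonneg _ _ (x.1 β).2.2.1]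
    change _ = max 0 (r.1 * (x.1 β).1 + (1 - q.1 * (x.1 β).1) - 1)
    ring_nf
  smul_smul' r q x := Subtype.ext <| funext fun β => UnitPart.ext (mul_assoc _ _ _).symm
  one_smul' x := Subtype.ext <| funext fun β => UnitPart.ext (one_mul _)

theorem SemisimpleTensor.smul_tmul (r s : UnitPart K) (a : A) :
    r • (tmul s a : SemisimpleTensor (UnitPart K) A) = tmul (r * s) a :=
  Subtype.ext <| funext fun β => UnitPart.ext (β.val_mul_left r s a).symm

end

end

/-! Write `F` for the free algebra with scalars in `P = [0,1] ∩ K` on `n` generators. Both `P ⊗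
(MV_n/J)` and `(P ⊗ MV_n)/(ι(J)]` are images of `F` (`freeMap`), since `r ⊗ f = r (1 ⊗ f)`. So it
suffices to compare two kernels. Finite presentability is independent of the chosen generators
(`FreeMV.exists_ker_eq_span`), hence `J = (u]` for one MV-term `u`. The kernel of `F → P ⊗ (MV_n/J)`
turns out to be the ideal of `u` in `F` (`freeMap_eq_zero_iff`), which gives the finite presentation
and the inclusion of this kernel in the other. The opposite inclusion is pointwise: a bimorphism `P
× A → [0,1]` has the form `(r, a) ↦ r h(a)` with `h` a homomorphism, so elements of `P ⊗ A` are
determined by their values at homomorphisms `A → [0,1]`, and those of `MV_n/J` kill `J`.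

The core is a Nullstellensatz (`FreeScalarMV.mem_span_of_eval_eq_zero`): a term that vanishes at all
real zeros of `u` lies in the ideal of `u`. If it did not, a quotient of `F` that is totally ordered
would satisfy `u = 0` and `t ≠ 0`. This chain may be non-Archimedean and need not embed in `[0,1]`,
but finitely many of its relations can be realized there. The chain is mapped to a `K`-vector space,
its nonzero elements generate a convex cone without `0`, and by Gordan's theorem any finite set of
them is made positive by one functional. Normalized at the unit, such a functional turns the
operations occurring in `t` and `u` into those of `[0,1]`, and so yields a real point with `u = 0`
and `t > 0`.

The vector space is built without lattice-ordered groups: a combination `∑ c_x x` with `c_x ≥ 0` is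
represented by the germ at infinity of `N ↦ ∑ (c_x / N) x`, whose sums are disjoint for large `N`
and therefore cancel. -/

section

open MVAlgebra

/-! ### Order, lattice and cancellation in MV-algebras -/

namespace MVAlgebra

variable {A : Type u} [MVAlgebra A]

theorem compl_odot (x y : A) : (odot x y)ᶜ = xᶜ + yᶜ := compl_compl' _

theorem compl_add (x y : A) : (x + y)ᶜ = odot xᶜ yᶜ := by
  rw [odot, compl_compl', compl_compl']

theorem odot_assoc (x y z : A) : odot (odot x y) z = odot x (odot y z) := by
  simp only [odot, compl_compl', add_assoc]

theorem odot_eq_zero_iff {x y : A} : odot x y = 0 ↔ Le x yᶜ := by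
  rw [Le, odot]
  exact ⟨fun h => by rw [← h, compl_compl'], fun h => by rw [h, compl_compl']⟩

theorem odot_compl_eq_zero_iff {x y : A} : odot x yᶜ = 0 ↔ Le x y := by
  rw [odot_eq_zero_iff, compl_compl']

theorem odot_self_compl (x : A) : odot x xᶜ = 0 := odot_compl_eq_zero_iff.2 (Le.refl x)

theorem join_comm (x y : A) : join x y = join y x := by
  have h := luk y x
  simp only [join, odot, compl_compl']
  rw [add_comm x, add_comm y]
  exact h

theorem join_eq_left {x y : A} (h : Le y x) : join x y = x := by
  rw [join, odot_compl_eq_zero_iff.2 h, add_zero]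

theorem join_eq_right {x y : A} (h : Le x y) : join x y = y := by
  rw [join_comm, join_eq_left h]

theorem Le.antisymm {x y : A} (h : Le x y) (h' : Le y x) : x = y := by
  rw [← join_eq_left h', join_eq_right h]

theorem Le.zero_le (x : A) : Le 0 x := compl_zero_add x

theorem Le.zero_iff {x : A} : Le x 0 ↔ x = 0 :=
  ⟨fun h => h.antisymm (Le.zero_le x), fun h => h ▸ Le.refl x⟩

theorem Le.le_one (x : A) : Le x (0 : A)ᶜ := by
  rw [Le, add_comm]; exact compl_zero_add _

theorem Le.compl {x y : A} (h : Le x y) : Le yᶜ xᶜ := by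
  rw [Le, compl_compl', add_comm]; exact h

theorem odot_le_iff {x y z : A} : Le (odot x y) z ↔ Le x (yᶜ + z) := by
  have h := odot_compl_le (x := x) (y := yᶜ) (z := z)
  rwa [compl_compl'] at h

theorem Le.odot {x y x' y' : A} (h : Le x y) (h' : Le x' y') : Le (odot x x') (odot y y') :=
  (h.compl.add h'.compl).compl

theorem odot_le_left (x y : A) : Le (odot x y) x := odot_le_iff.2 (le_add_left _ _)

theorem odot_le_right (x y : A) : Le (odot x y) y := odot_comm y x ▸ odot_le_left y x

theorem le_join_left (x y : A) : Le x (join x y) := le_add_right _ _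

theorem le_join_right (x y : A) : Le y (join x y) := join_comm y x ▸ le_join_left y x

theorem add_odot_compl {x z : A} (h : Le x z) : x + odot z xᶜ = z := join_eq_right h

theorem join_le {x y z : A} (h : Le x z) (h' : Le y z) : Le (join x y) z := by
  rw [← add_odot_compl h]
  exact (Le.refl x).add (h'.odot (Le.refl _))

theorem meet_le_left (x y : A) : Le (meet x y) x := by
  have h := (le_join_left xᶜ yᶜ).compl
  rwa [compl_compl'] at h

theorem meet_le_right (x y : A) : Le (meet x y) y := by
  have h := (le_join_right xᶜ yᶜ).compl
  rwa [compl_compl'] at h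

theorem le_meet {x y z : A} (h : Le z x) (h' : Le z y) : Le z (meet x y) := by
  have h := (join_le h.compl h'.compl).compl
  rwa [compl_compl'] at h

/-- Translation `w ↦ x ⊕ w` has the left adjoint `w ↦ w ⊙ x*` (`odot_compl_le`), so it preserves
meets. -/
theorem add_meet (x y z : A) : x + meet y z = meet (x + y) (x + z) := by
  refine Le.antisymm (le_meet ((Le.refl x).add (meet_le_left _ _))
    ((Le.refl x).add (meet_le_right _ _))) ?_
  refine odot_compl_le.1 (le_meet ?_ ?_)
  · exact odot_compl_le.2 (meet_le_left _ _)
  · exact odot_compl_le.2 (meet_le_right _ _)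

theorem meet_comm (x y : A) : meet x y = meet y x := by
  rw [meet, join_comm, ← meet]

theorem meet_eq_odot (x y : A) : meet x y = odot x (y + xᶜ) := by
  rw [meet, join, compl_add, compl_compl', compl_odot, compl_compl']

theorem meet_eq_left {x y : A} (h : Le x y) : meet x y = x :=
  (meet_le_left x y).antisymm (le_meet (Le.refl x) h)

/-- Disjointness means `x ≤ y*`, so `x = y* ∧ x = y* ⊙ (x ⊕ y)`. All cancellation below comes from
this. -/
theorem add_odot_compl_right {x y : A} (h : odot x y = 0) : odot (x + y) yᶜ = x := by
  have h1 := meet_eq_odot yᶜ x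
  rw [compl_compl', meet_comm, meet_eq_left (odot_eq_zero_iff.1 h), odot_comm] at h1
  exact h1.symm

/-- Disjoint sums are cancellative. -/
theorem eq_zero_of_add_eq_self {x y : A} (h : x + y = y) (h' : odot x y = 0) : x = 0 := by
  rw [← add_odot_compl_right h', h, odot_self_compl]

/-- Any sum can be replaced by a disjoint one, since `y ∧ x*` is disjoint from `x`. Bimorphisms
respect only disjoint sums and lattice operations, and this recovers `⊕` from them. -/
theorem add_meet_compl (x y : A) : x + meet y xᶜ = x + y := by
  rw [add_meet, add_comm x xᶜ, add_compl_self, meet_eq_left (Le.le_one _)]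

/-- Prelinearity. -/
theorem meet_odot_compl (x y : A) : meet (odot x yᶜ) (odot y xᶜ) = 0 := by
  have key : ∀ x y : A, meet x y + odot x yᶜ = x := by
    intro x y
    have h : odot x (odot x yᶜ)ᶜ = meet x y := by
      rw [meet_eq_odot, compl_odot, compl_compl', add_comm]
    rw [← h, add_comm]
    exact add_odot_compl (odot_le_left _ _)
  -- Adding `x ∧ y` to the two remainders gives back `x` and `y`, so adding it to their meet gives
  -- `x ∧ y` again; the sum is disjoint, hence that meet is `0`.
  have h := add_meet (meet x y) (odot x yᶜ) (odot y xᶜ)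
  rw [key, meet_comm x y, key, meet_comm y x, add_comm] at h
  refine eq_zero_of_add_eq_self h (odot_eq_zero_iff.2 ?_)
  exact (meet_le_left _ _).trans ((odot_le_right _ _).trans (meet_le_right x y).compl)

theorem meet_add_eq_zero {x y z : A} (h : meet x y = 0) (h' : meet x z = 0) :
    meet x (y + z) = 0 := by
  rw [← Le.zero_iff, ← h']
  refine le_meet (meet_le_left _ _) ?_
  -- The right side is `z ⊕ (x ∧ y) = z`.
  have h1 : Le (meet x (y + z)) (meet (z + x) (z + y)) :=
    le_meet ((meet_le_left _ _).trans (le_add_left _ _)) (add_comm y z ▸ meet_le_right x (y + z))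
  rwa [← add_meet, h, add_zero] at h1

theorem meet_nsmul_eq_zero {x y : A} (h : meet x y = 0) (n : ℕ) : meet x (n • y) = 0 := by
  induction n with
  | zero => rw [zero_nsmul]; exact Le.zero_iff.1 (meet_le_right _ _)
  | succ n ih => rw [succ_nsmul]; exact meet_add_eq_zero ih h

theorem eq_of_chang_eq_zero {x y : A} (h : chang x y = 0) : x = y := by
  have h1 : Le (odot x yᶜ) (chang x y) := le_add_right _ _
  have h2 : Le (odot xᶜ y) (chang x y) := le_add_left _ _
  rw [h, Le.zero_iff] at h1 h2
  rw [odot_comm] at h2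
  exact (odot_compl_eq_zero_iff.1 h1).antisymm (odot_compl_eq_zero_iff.1 h2)

theorem chang_self (x : A) : chang x x = 0 := by
  rw [chang, odot_comm xᶜ, odot_self_compl, add_zero]

theorem chang_zero (x : A) : chang x 0 = x := by
  rw [chang, odot_comm xᶜ, ← compl_compl' (odot x _), compl_odot, compl_compl', add_zero,
    compl_compl', Le.zero_iff.1 (odot_le_left 0 xᶜ), add_zero]

end MVAlgebra

/-! ### Ideals with totally ordered quotient -/

namespace MVIdeal

variable {A : Type u} [MVAlgebra A]

theorem subset_span (S : Set A) : S ⊆ (span S).carrier := fun _ h _ hI => hI h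

theorem cls_eq_zero (J : MVIdeal A) {x : A} : J.cls x = 0 ↔ x ∈ J.carrier := by
  rw [show (0 : J.Quotient) = J.cls 0 from rfl, cls_eq, chang_zero]

/-- The ideal generated by an ideal and an element. -/
def adjoin (J : MVIdeal A) (a : A) : MVIdeal A where
  carrier := {x | ∃ i ∈ J.carrier, ∃ n : ℕ, Le x (i + n • a)}
  zero_mem := ⟨0, J.zero_mem, 0, Le.zero_le _⟩
  add_mem := by
    rintro x y ⟨i, hi, n, hx⟩ ⟨j, hj, m, hy⟩
    refine ⟨i + j, J.add_mem hi hj, n + m, ?_⟩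
    rw [add_nsmul, add_add_add_comm]
    exact hx.add hy
  lower := by
    rintro x y h ⟨i, hi, n, hy⟩
    exact ⟨i, hi, n, h.trans hy⟩

/-- From `x ≤ i ⊕ n a` and `x ≤ j ⊕ m b` one gets `x ≤ (i ⊕ j) ⊕ (n a ∧ m b)`, and multiples of
orthogonal elements stay orthogonal. -/
theorem adjoin_inter (J : MVIdeal A) {a b x : A} (h : meet a b = 0)
    (ha : x ∈ (J.adjoin a).carrier) (hb : x ∈ (J.adjoin b).carrier) : x ∈ J.carrier := by
  obtain ⟨i, hi, n, hx⟩ := ha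
  obtain ⟨j, hj, m, hy⟩ := hb
  have h0 : meet (n • a) (m • b) = 0 := by
    apply meet_nsmul_eq_zero
    rw [meet_comm] at h ⊢
    exact meet_nsmul_eq_zero h n
  refine J.lower ?_ (J.add_mem hi hj)
  rw [← add_zero (i + j), ← h0, add_meet]
  refine le_meet (hx.trans ((le_add_right _ _).add (Le.refl _)))
    (hy.trans ((le_add_left _ _).add (Le.refl _)))

/-- An element outside an ideal is avoided by a larger ideal whose quotient is totally ordered. -/
theorem exists_total (J : MVIdeal A) {t : A} (ht : t ∉ J.carrier) :
    ∃ I : MVIdeal A, J.carrier ⊆ I.carrier ∧ t ∉ I.carrier ∧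
      ∀ x y : I.Quotient, Le x y ∨ Le y x := by
  obtain ⟨M, hJM, hM⟩ := zorn_subset_nonempty
    {S : Set A | ∃ I : MVIdeal A, I.carrier = S ∧ t ∉ S} (by
      intro c hc hchain hne
      refine ⟨⋃₀ c, ⟨⟨⋃₀ c, ?_, ?_, ?_⟩, rfl, ?_⟩, fun s hs => Set.subset_sUnion_of_mem hs⟩
      · obtain ⟨S, hS⟩ := hne
        obtain ⟨I, rfl, -⟩ := hc hS
        exact ⟨_, hS, I.zero_mem⟩
      · rintro x y ⟨S, hS, hx⟩ ⟨T, hT, hy⟩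
        rcases hchain.total hS hT with h | h
        · obtain ⟨I, rfl, -⟩ := hc hT
          exact ⟨_, hT, I.add_mem (h hx) hy⟩
        · obtain ⟨I, rfl, -⟩ := hc hS
          exact ⟨_, hS, I.add_mem hx (h hy)⟩
      · rintro x y h ⟨S, hS, hy⟩
        obtain ⟨I, rfl, -⟩ := hc hS
        exact ⟨_, hS, I.lower h hy⟩
      · rintro ⟨S, hS, h⟩
        obtain ⟨I, rfl, h'⟩ := hc hS
        exact h' h) J.carrier ⟨J, rfl, ht⟩
  obtain ⟨⟨I, rfl, hI⟩, hmax⟩ := hM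
  refine ⟨I, hJM, hI, ?_⟩
  -- `I` is maximal among the ideals avoiding `t`, so adjoining any new element brings `t` in. With
  -- `adjoin_inter` and prelinearity, one of `x ⊙ y*`, `y ⊙ x*` must already lie in `I`.
  have key : ∀ a : A, t ∈ (I.adjoin a).carrier ∨ a ∈ I.carrier := by
    intro a
    by_contra! hcon
    refine hcon.2 (hmax ⟨I.adjoin a, rfl, hcon.1⟩ ?_ ⟨0, I.zero_mem, 1, ?_⟩)
    · exact fun x hx => ⟨x, hx, 0, le_add_right _ _⟩
    · rw [one_nsmul, zero_add]; exact Le.refl _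
  have hle : ∀ x y : A, odot x yᶜ ∈ I.carrier → Le (I.cls x) (I.cls y) := by
    intro x y h
    exact odot_compl_eq_zero_iff.1 (I.cls_eq_zero.2 h)
  rintro ⟨x⟩ ⟨y⟩
  rcases key (odot x yᶜ) with h | h
  · rcases key (odot y xᶜ) with h' | h'
    · exact absurd (I.adjoin_inter (meet_odot_compl x y) h h') hI
    · exact .inr (hle _ _ h')
  · exact .inl (hle _ _ h)

end MVIdeal

/-- Gordan's theorem over an ordered field: finitely many vectors of a convex cone that does not
contain `0` lie in an open half-space. -/
theorem ConvexCone.exists_dual_pos {k V : Type*} [Field k] [LinearOrder k] [IsStrictOrderedRing k]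
    [AddCommGroup V] [Module k V] (P : ConvexCone k V) (h0 : (0 : V) ∉ P) (S : Finset V)
    (hS : ∀ s ∈ S, s ∈ P) : ∃ φ : V →ₗ[k] k, ∀ s ∈ S, 0 < φ s := by
  classical
  -- Induction on a bound for the dimension of a subspace containing the vectors, with the ambient
  -- cone fixed.
  suffices H : ∀ (n : ℕ) (W : Submodule k V), FiniteDimensional k W → Module.finrank k W ≤ n →
      ∀ S : Finset V, (∀ s ∈ S, s ∈ P ∧ s ∈ W) → ∃ φ : V →ₗ[k] k, ∀ s ∈ S, 0 < φ s from
    H _ (Submodule.span k S) (FiniteDimensional.span_finset k S) le_rfl S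
      fun s hs => ⟨hS s hs, Submodule.subset_span hs⟩
  intro n
  induction n with
  | zero =>
    intro W _ hn S hS
    have hW : W = ⊥ := Submodule.finrank_eq_zero.1 (Nat.le_zero.1 hn)
    refine ⟨0, fun s hs => absurd ?_ h0⟩
    obtain ⟨h1, h2⟩ := hS s hs
    rw [hW, Submodule.mem_bot] at h2
    exact h2 ▸ h1
  | succ n ih =>
    intro W _ hn S hS
    by_cases hS0 : S = ∅
    · exact ⟨0, by simp [hS0]⟩
    obtain ⟨w, hw⟩ := Finset.nonempty_iff_ne_empty.2 hS0
    have hw0 : w ≠ 0 := fun h => h0 (h ▸ (hS w hw).1)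
    obtain ⟨l, hl⟩ : ∃ l : V →ₗ[k] k, l w ≠ 0 := by
      by_contra! h
      exact hw0 ((Module.forall_dual_apply_eq_zero_iff k w).1 h)
    have hlt : W ⊓ LinearMap.ker l < W := by
      refine lt_of_le_of_ne inf_le_left fun h => hl ?_
      have := (hS w hw).2
      rw [← h] at this
      exact this.2
    let up := S.filter fun s => 0 < l s
    let dn := S.filter fun s => l s < 0
    -- Fourier–Motzkin elimination along `l`: vectors in the kernel are kept, and each vector with
    -- `l > 0` is paired with each one with `l < 0`, scaled so that `l` cancels. The results stay in
    -- the cone.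
    obtain ⟨ψ, hψ⟩ := ih (W ⊓ LinearMap.ker l)
      (Submodule.finiteDimensional_of_le inf_le_left)
      (Nat.lt_succ_iff.1 ((Submodule.finrank_lt_finrank_of_lt hlt).trans_le hn))
      (S.filter (fun s => l s = 0) ∪
        (up ×ˢ dn).image fun p => (l p.1)⁻¹ • p.1 + (-l p.2)⁻¹ • p.2) (by
        intro s hs
        rcases Finset.mem_union.1 hs with hs | hs
        · obtain ⟨h1, h2⟩ := Finset.mem_filter.1 hs
          exact ⟨(hS s h1).1, (hS s h1).2, h2⟩
        · obtain ⟨⟨a, b⟩, hab, rfl⟩ := Finset.mem_image.1 hs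
          obtain ⟨ha, hb⟩ := Finset.mem_product.1 hab
          obtain ⟨ha, ha'⟩ := Finset.mem_filter.1 ha
          obtain ⟨hb, hb'⟩ := Finset.mem_filter.1 hb
          dsimp only at *
          refine ⟨P.add_mem (P.smul_mem (inv_pos.2 ha') (hS a ha).1)
            (P.smul_mem (inv_pos.2 (neg_pos.2 hb')) (hS b hb).1),
            W.add_mem (W.smul_mem _ (hS a ha).2) (W.smul_mem _ (hS b hb).2), ?_⟩
          change l _ = 0
          rw [map_add, map_smul, map_smul, smul_eq_mul, smul_eq_mul,
            inv_mul_cancel₀ ha'.ne', inv_neg, neg_mul, inv_mul_cancel₀ hb'.ne, add_neg_cancel])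
    -- Positivity of `ψ + c l` bounds `c` below on `up` and above on `dn`; positivity of `ψ` on the
    -- paired vectors says exactly that every lower bound is less than every upper bound.
    obtain ⟨c, hc, hc'⟩ := Order.exists_between_finsets (up.image fun s => -(ψ s / l s))
      (dn.image fun s => ψ s / -l s) (by
        intro x hx y hy
        obtain ⟨a, ha, rfl⟩ := Finset.mem_image.1 hx
        obtain ⟨b, hb, rfl⟩ := Finset.mem_image.1 hy
        have := hψ _ (Finset.mem_union_right _
          (Finset.mem_image_of_mem _ (Finset.mk_mem_product ha hb)))
        rw [map_add, map_smul, map_smul, smul_eq_mul, smul_eq_mul] at this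
        rw [neg_lt_iff_pos_add, div_eq_inv_mul, div_eq_inv_mul, add_comm]
        exact this)
    refine ⟨ψ + c • l, fun s hs => ?_⟩
    rw [LinearMap.add_apply, LinearMap.smul_apply, smul_eq_mul]
    rcases lt_trichotomy (l s) 0 with h | h | h
    · have := hc' _ (Finset.mem_image_of_mem _ (Finset.mem_filter.2 ⟨hs, h⟩))
      rw [lt_div_iff₀ (neg_pos.2 h)] at this
      linarith
    · rw [h, mul_zero, add_zero]
      exact hψ s (Finset.mem_union_left _ (Finset.mem_filter.2 ⟨hs, h⟩))
    · have := hc _ (Finset.mem_image_of_mem _ (Finset.mem_filter.2 ⟨hs, h⟩))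
      rw [← neg_div, div_lt_iff₀ h] at this
      linarith

/-! ### The unit intervals -/

namespace UnitPart

variable {K : Subfield ℝ}

theorem le_iff {x y : UnitPart K} : Le x y ↔ x.1 ≤ y.1 := by
  rw [← odot_compl_eq_zero_iff, UnitPart.ext_iff, val_odot, val_compl, val_zero]
  constructor
  · intro h
    linarith [le_max_right (0 : ℝ) (x.1 + (1 - y.1) - 1)]
  · intro h
    exact max_eq_left (by linarith)

theorem odot_eq_zero_iff {x y : UnitPart K} : odot x y = 0 ↔ x.1 + y.1 ≤ 1 := by
  rw [MVAlgebra.odot_eq_zero_iff, le_iff, val_compl, le_sub_iff_add_le]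

theorem val_add_of_le {x y : UnitPart K} (h : x.1 + y.1 ≤ 1) : (x + y).1 = x.1 + y.1 := by
  rw [val_add, min_eq_right h]

theorem one_eq : (1 : UnitPart K) = (0 : UnitPart K)ᶜ := UnitPart.ext (sub_zero _).symm

theorem val_join (x y : UnitPart K) : (join x y).1 = max x.1 y.1 := by
  have hx := x.2.2.2
  have hy := y.2.2.2
  rw [join, val_add, val_odot, val_compl]
  grind

theorem val_meet (x y : UnitPart K) : (meet x y).1 = min x.1 y.1 := by
  rw [meet, val_compl, val_join, val_compl, val_compl]
  grind

theorem exists_nsmul_eq_one {r : UnitPart K} (h : 0 < r.1) : ∃ n : ℕ, n • r = 1 := by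
  obtain ⟨n, hn⟩ := exists_nat_ge r.1⁻¹
  refine ⟨n, UnitPart.ext ?_⟩
  have key : ∀ m : ℕ, (m • r).1 = min 1 (m * r.1) := by
    intro m
    induction m with
    | zero => simp [val_zero]
    | succ m ih =>
      rw [succ_nsmul, val_add, ih]
      push_cast
      have := r.2.2.1
      grind
  rw [key, val_one]
  exact min_eq_left ((inv_le_iff_one_le_mul₀ h).1 hn)

/-- The nearest point of `[0,1] ∩ K`. -/
def clamp (c : K) : UnitPart K :=
  ⟨max 0 (min 1 c), by
    rcases max_choice (0 : ℝ) (min 1 c) with h | h <;> rw [h]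
    · exact K.zero_mem
    · rcases min_choice (1 : ℝ) c with h | h <;> rw [h]
      exacts [K.one_mem, c.2], le_max_left _ _, max_le zero_le_one (min_le_left _ _)⟩

theorem val_clamp {c : K} (h : 0 ≤ c) (h' : c ≤ 1) : (clamp c).1 = c := by
  have h : (0 : ℝ) ≤ c := h
  have h' : (c : ℝ) ≤ 1 := h'
  change max 0 (min 1 (c : ℝ)) = c
  rw [min_eq_right h', max_eq_right h]

end UnitPart

/-! ### Arithmetic of the scalar multiplication -/

namespace ScalarMVAlgebra

variable {K : Subfield ℝ} {A : Type u} [MVAlgebra A] [ScalarMVAlgebra K A]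

theorem zero_smul' (x : A) : (0 : UnitPart K) • x = 0 := by
  have h := odot_compl_smul (0 : UnitPart K) 0 x
  rwa [odot_self_compl, odot_self_compl] at h

theorem smul_zero' (r : UnitPart K) : r • (0 : A) = 0 := by
  have h := smul_odot_compl r (0 : A) 0
  rwa [odot_self_compl, odot_self_compl] at h

theorem smul_mono_left {r s : UnitPart K} (h : Le r s) (x : A) : Le (r • x) (s • x) := by
  rw [← odot_compl_eq_zero_iff] at *
  rw [← odot_compl_smul, h, zero_smul']

theorem smul_mono_right (r : UnitPart K) {x y : A} (h : Le x y) : Le (r • x) (r • y) := by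
  rw [← odot_compl_eq_zero_iff] at *
  rw [← smul_odot_compl, h, smul_zero']

theorem add_smul_le (r s : UnitPart K) (x : A) : Le ((r + s) • x) (r • x + s • x) := by
  rw [add_comm (r • x), ← odot_compl_le, ← odot_compl_smul]
  apply smul_mono_left
  rw [odot_compl_le, add_comm]
  exact Le.refl _

/-- By disjointness `r = (r ⊕ s) ⊙ s*`; the axiom for differences of scalars gives `r x = (r ⊕ s) x
⊙ (s x)*`, and adding back `s x ≤ (r ⊕ s) x` restores `(r ⊕ s) x`. -/
theorem add_smul_of_odot {r s : UnitPart K} (h : odot r s = 0) (x : A) :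
    (r + s) • x = r • x + s • x := by
  have h1 := odot_compl_smul (r + s) s x
  rw [add_odot_compl_right h] at h1
  rw [h1, add_comm (odot _ _), add_odot_compl (smul_mono_left (le_add_left _ _) x)]

theorem smul_add_of_odot (r : UnitPart K) {x y : A} (h : odot x y = 0) :
    r • (x + y) = r • x + r • y := by
  have h1 := smul_odot_compl r (x + y) y
  rw [add_odot_compl_right h] at h1
  rw [h1, add_comm (odot _ _), add_odot_compl (smul_mono_right r (le_add_left _ _))]

theorem odot_smul {r s : UnitPart K} (h : odot r s = 0) (x : A) : odot (r • x) (s • x) = 0 := by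
  have h1 := odot_compl_smul (r + s) s x
  rw [add_odot_compl_right h] at h1
  rw [h1, odot_assoc, odot_comm _ (s • x), odot_self_compl]
  exact Le.zero_iff.1 (odot_le_right _ _)

theorem nsmul_smul_le (n : ℕ) (r : UnitPart K) (x : A) : Le ((n • r) • x) (n • (r • x)) := by
  induction n with
  | zero => rw [zero_nsmul, zero_nsmul, zero_smul']; exact Le.refl _
  | succ n ih =>
    rw [succ_nsmul, succ_nsmul]
    exact (add_smul_le _ _ _).trans (ih.add (Le.refl _))

/-- The scalars are Archimedean: some multiple of `r` is `1`, so `x` is at most a multiple of `r x`.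
-/
theorem eq_zero_of_smul_eq_zero {r : UnitPart K} (hr : 0 < r.1) {x : A} (h : r • x = 0) :
    x = 0 := by
  obtain ⟨n, hn⟩ := UnitPart.exists_nsmul_eq_one hr
  have := nsmul_smul_le n r x
  rwa [hn, h, nsmul_zero, one_smul', Le.zero_iff] at this

end ScalarMVAlgebra

/-! ## The vector space of formal combinations of elements of a scalar MV-algebra -/

namespace ScalarMVAlgebra

open Filter

section

variable {K : Subfield ℝ} {A : Type u}

/-- The nonnegative elements of a subfield of `ℝ`. -/
def NonnegPart (K : Subfield ℝ) : Type := {c : K // 0 ≤ c}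

noncomputable instance : CommSemiring (NonnegPart K) := inferInstanceAs (CommSemiring {c : K // 0 ≤ c})

instance : Nontrivial (NonnegPart K) := inferInstanceAs (Nontrivial {c : K // 0 ≤ c})

/-- The inclusion of the nonnegative elements. -/
def NonnegPart.coeHom (K : Subfield ℝ) : NonnegPart K →+ K where
  toFun c := c.1
  map_zero' := rfl
  map_add' _ _ := rfl

/-- The element of `NonnegPart K` given by a nonnegative number. -/
def NonnegPart.mk (c : K) (h : 0 ≤ c) : NonnegPart K := ⟨c, h⟩

/-- The inclusion of the formal combinations with nonnegative coefficients. -/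
noncomputable def combCoe (K : Subfield ℝ) (A : Type u) : (A →₀ NonnegPart K) →+ (A →₀ K) :=
  Finsupp.mapRange.addMonoidHom (NonnegPart.coeHom K)

theorem combCoe_apply (f : A →₀ NonnegPart K) (x : A) : combCoe K A f x = (f x).1 := rfl

theorem combCoe_injective : Function.Injective (combCoe K A) := fun f g h => by
  ext x
  have := DFunLike.congr_fun h x
  rw [combCoe_apply, combCoe_apply] at this
  exact Subtype.ext this

theorem combCoe_smul {c : K} (hc : 0 ≤ c) (f : A →₀ NonnegPart K) :
    combCoe K A (NonnegPart.mk c hc • f) = c • combCoe K A f := by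
  ext x; rfl

theorem combCoe_single (x : A) (c : NonnegPart K) :
    combCoe K A (Finsupp.single x c) = Finsupp.single x c.1 :=
  Finsupp.mapRange_single (hf := map_zero (NonnegPart.coeHom K))

/-- For `0 ≤ c ≤ N` the scalar `c / N`. -/
noncomputable def fraction (c : NonnegPart K) (N : ℕ) : UnitPart K :=
  UnitPart.clamp (c.1 / N)

theorem val_fraction {c : NonnegPart K} {N : ℕ} (hN : 0 < N) (h : c.1 ≤ N) :
    (fraction c N).1 = (c.1 : ℝ) / N := by
  have hN' : (0 : K) < N := Nat.cast_pos.2 hN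
  rw [fraction, UnitPart.val_clamp (div_nonneg c.2 hN'.le) ((div_le_one hN').2 h)]
  push_cast
  rfl

/-- `fraction c N` has its intended value only for `N > 0` and `c ≤ N`; otherwise it is clamped or
comes from division by zero. Germs at infinity do not see these cases. -/
theorem eventually_le (c : K) : ∀ᶠ N : ℕ in atTop, 0 < N ∧ c ≤ N := by
  obtain ⟨n, hn⟩ := exists_nat_ge (c : ℝ)
  filter_upwards [eventually_ge_atTop (n + 1)] with N hN
  refine ⟨by omega, ?_⟩
  have h : (c : ℝ) ≤ (N : ℝ) := hn.trans (Nat.cast_le.2 (by omega))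
  rw [← Subtype.coe_le_coe]
  push_cast
  exact h

theorem fraction_add {c d : NonnegPart K} {N : ℕ} (hN : 0 < N) (h : c.1 + d.1 ≤ N) :
    odot (fraction c N) (fraction d N) = 0 ∧
      fraction (c + d) N = fraction c N + fraction d N := by
  have hN' : (0 : ℝ) < N := Nat.cast_pos.2 hN
  have hc : (fraction c N).1 = (c.1 : ℝ) / N :=
    val_fraction hN ((le_add_of_nonneg_right d.2).trans h)
  have hd : (fraction d N).1 = (d.1 : ℝ) / N :=
    val_fraction hN ((le_add_of_nonneg_left c.2).trans h)
  have hcd : (fraction (c + d) N).1 = ((c.1 + d.1 : K) : ℝ) / N := val_fraction hN h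
  have hle : (fraction c N).1 + (fraction d N).1 ≤ 1 := by
    rw [hc, hd, ← add_div, div_le_one hN']
    have := Subtype.coe_le_coe.2 h
    push_cast at this
    exact this
  refine ⟨UnitPart.odot_eq_zero_iff.2 hle, UnitPart.ext ?_⟩
  rw [UnitPart.val_add_of_le hle, hcd, hc, hd]
  push_cast
  ring

variable [MVAlgebra A] [ScalarMVAlgebra K A]

/-- The germ at infinity of `N ↦ (c / N) x`, which is additive in `c`. -/
noncomputable def smulGerm (x : A) : NonnegPart K →+ Germ (atTop : Filter ℕ) A where
  toFun c := ((fun N => fraction c N • x : ℕ → A) : Germ atTop A)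
  map_zero' := by
    refine Germ.coe_eq.2 ?_
    filter_upwards [eventually_le (0 : K)] with N hN
    rw [show fraction (0 : NonnegPart K) N = 0 from
      UnitPart.ext (by rw [val_fraction hN.1 hN.2]; exact zero_div _), zero_smul']
  map_add' c d := by
    refine Germ.coe_eq.2 ?_
    filter_upwards [eventually_le (c.1 + d.1)] with N hN
    obtain ⟨h1, h2⟩ := fraction_add hN.1 hN.2
    rw [h2, add_smul_of_odot h1]

theorem smulGerm_apply (x : A) (c : NonnegPart K) :
    smulGerm x c = ((fun N => fraction c N • x : ℕ → A) : Germ atTop A) := rfl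

theorem smulGerm_add {x y : A} (h : odot x y = 0) (c : NonnegPart K) :
    smulGerm (x + y) c = smulGerm x c + smulGerm y c := by
  refine Germ.coe_eq.2 (Eventually.of_forall fun N => ?_)
  exact smul_add_of_odot _ h

theorem smulGerm_smul (r : UnitPart K) (x : A) (c : NonnegPart K) :
    smulGerm (r • x) c = smulGerm x (c * (NonnegPart.mk ⟨r.1, r.2.1⟩ r.2.2.1)) := by
  refine Germ.coe_eq.2 ?_
  filter_upwards [eventually_le c.1] with N hN
  have hr : (⟨r.1, r.2.1⟩ : K) ≤ 1 := r.2.2.2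
  rw [smul_smul']
  congr 1
  apply UnitPart.ext
  rw [UnitPart.val_mul, val_fraction hN.1 hN.2,
    val_fraction hN.1 ((mul_le_of_le_one_right c.2 hr).trans hN.2)]
  change _ = (c.1.1 * r.1) / N
  ring

/-- The germ of a formal combination of elements with nonnegative coefficients. -/
noncomputable def combGerm (K : Subfield ℝ) (A : Type u) [MVAlgebra A] [ScalarMVAlgebra K A] :
    (A →₀ NonnegPart K) →+ Germ (atTop : Filter ℕ) A :=
  Finsupp.liftAddHom smulGerm

theorem combGerm_single (x : A) (c : NonnegPart K) :
    combGerm K A (Finsupp.single x c) = smulGerm x c :=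
  Finsupp.liftAddHom_apply_single _ _ _

/-- Domination by `(c / N) 1` shows that the values become small, which makes two combinations
disjoint for large `N`. -/
theorem combGerm_bounded (f : A →₀ NonnegPart K) :
    ∃ c : NonnegPart K, Germ.LiftRel Le (combGerm K A f) (smulGerm (0 : A)ᶜ c) := by
  induction f using Finsupp.induction_linear with
  | zero =>
    refine ⟨0, ?_⟩
    rw [map_zero, map_zero]
    exact Germ.liftRel_coe.2 (Eventually.of_forall fun _ => Le.refl _)
  | add f g hf hg =>
    obtain ⟨c, hc⟩ := hf
    obtain ⟨d, hd⟩ := hg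
    refine ⟨c + d, ?_⟩
    rw [map_add, map_add]
    revert hc hd
    generalize combGerm K A f = a
    generalize combGerm K A g = b
    refine Germ.inductionOn₂ a b fun a b hc hd => ?_
    refine Germ.liftRel_coe.2 ?_
    filter_upwards [Germ.liftRel_coe.1 hc, Germ.liftRel_coe.1 hd] with N h1 h2
    exact h1.add h2
  | single x c =>
    refine ⟨c, ?_⟩
    rw [combGerm_single]
    exact Germ.liftRel_coe.2 (Eventually.of_forall fun N => smul_mono_right _ (Le.le_one x))

/-- For `N ≥ c + d` the bounds `(c / N) 1` and `(d / N) 1` are disjoint, hence so are the elements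
below them, and disjoint sums cancel. -/
theorem combGerm_eq_zero {f g : A →₀ NonnegPart K}
    (h : combGerm K A f + combGerm K A g = combGerm K A g) : combGerm K A f = 0 := by
  obtain ⟨c, hc⟩ := combGerm_bounded f
  obtain ⟨d, hd⟩ := combGerm_bounded g
  revert hc hd h
  generalize combGerm K A f = a
  generalize combGerm K A g = b
  refine Germ.inductionOn₂ a b fun a b h hc hd => ?_
  refine Germ.coe_eq.2 ?_
  filter_upwards [Germ.liftRel_coe.1 hc, Germ.liftRel_coe.1 hd, Germ.coe_eq.1 h,
    eventually_le (c.1 + d.1)] with N h1 h2 h3 h4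
  refine eq_zero_of_add_eq_self h3 (Le.zero_iff.1 ?_)
  rw [← odot_smul (fraction_add h4.1 h4.2).1 (0 : A)ᶜ]
  exact h1.odot h2

theorem eq_zero_of_smulGerm_eq_zero {x : A} {c : NonnegPart K} (hc : c ≠ 0)
    (h : smulGerm x c = 0) : x = 0 := by
  obtain ⟨N, h1, h2⟩ := ((Germ.coe_eq.1 h).and (eventually_le c.1)).exists
  refine eq_zero_of_smul_eq_zero ?_ h1
  rw [val_fraction h2.1 h2.2]
  have hc' : (0 : K) < c.1 := lt_of_le_of_ne c.2 fun h => hc (Subtype.ext h.symm)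
  exact div_pos hc' (Nat.cast_pos.2 h2.1)

/-- Each summand lies below the sum, so it vanishes eventually. -/
theorem eq_zero_of_combGerm_eq_zero {f : A →₀ NonnegPart K} (h : combGerm K A f = 0) {x : A}
    (hx : f x ≠ 0) : x = 0 := by
  refine eq_zero_of_smulGerm_eq_zero hx ?_
  rw [← Finsupp.single_add_erase x f, map_add, combGerm_single] at h
  revert h
  rw [smulGerm_apply]
  generalize combGerm K A (f.erase x) = b
  refine Germ.inductionOn b fun b h => ?_
  refine Germ.coe_eq.2 ?_
  filter_upwards [Germ.coe_eq.1 h] with N hN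
  refine Le.zero_iff.1 ?_
  change _ + _ = (0 : A) at hN
  rw [← hN]
  exact le_add_right _ _

/-- The formal combinations that vanish. -/
noncomputable def nullComb (K : Subfield ℝ) (A : Type u) [MVAlgebra A] [ScalarMVAlgebra K A] :
    Submodule K (A →₀ K) where
  -- Equality of germs is required after scaling by every `r`, so stability under nonnegative
  -- scalars is built in; for a negative scalar `f` and `g` change places.
  carrier := {h | ∃ f g : A →₀ NonnegPart K, h = combCoe K A f - combCoe K A g ∧
    ∀ r : NonnegPart K, combGerm K A (r • f) = combGerm K A (r • g)}
  zero_mem' := ⟨0, 0, by simp, fun _ => rfl⟩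
  add_mem' := by
    rintro _ _ ⟨f, g, rfl, h⟩ ⟨f', g', rfl, h'⟩
    refine ⟨f + f', g + g', ?_, fun r => ?_⟩
    · rw [map_add, map_add]; abel
    · rw [smul_add, smul_add, map_add, map_add, h, h']
  smul_mem' := by
    rintro c _ ⟨f, g, rfl, h⟩
    rcases le_total 0 c with hc | hc
    · refine ⟨NonnegPart.mk c hc • f, NonnegPart.mk c hc • g, ?_, fun r => ?_⟩
      · rw [combCoe_smul, combCoe_smul, smul_sub]
      · rw [smul_smul, smul_smul, h]
    · have hc' : 0 ≤ -c := neg_nonneg.2 hc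
      refine ⟨NonnegPart.mk (-c) hc' • g, NonnegPart.mk (-c) hc' • f, ?_, fun r => ?_⟩
      · rw [combCoe_smul, combCoe_smul, smul_sub, neg_smul, neg_smul]; abel
      · rw [smul_smul, smul_smul, h]

/-- The `K`-vector space enveloping a scalar MV-algebra. -/
def Envelope (K : Subfield ℝ) (A : Type u) [MVAlgebra A] [ScalarMVAlgebra K A] : Type u :=
  (A →₀ K) ⧸ nullComb K A

noncomputable instance : AddCommGroup (Envelope K A) :=
  inferInstanceAs (AddCommGroup ((A →₀ K) ⧸ nullComb K A))

noncomputable instance : Module K (Envelope K A) :=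
  inferInstanceAs (Module K ((A →₀ K) ⧸ nullComb K A))

/-- The class of a formal combination in the envelope. -/
noncomputable def Envelope.mk (K : Subfield ℝ) (A : Type u) [MVAlgebra A] [ScalarMVAlgebra K A] :
    (A →₀ K) →ₗ[K] Envelope K A :=
  (nullComb K A).mkQ

theorem Envelope.mk_eq_zero {f : A →₀ K} : Envelope.mk K A f = 0 ↔ f ∈ nullComb K A :=
  Submodule.Quotient.mk_eq_zero _

/-- The canonical map into the envelope. -/
noncomputable def toEnvelope (K : Subfield ℝ) {A : Type u} [MVAlgebra A] [ScalarMVAlgebra K A]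
    (x : A) : Envelope K A :=
  Envelope.mk K A (Finsupp.single x 1)

theorem toEnvelope_add {x y : A} (h : odot x y = 0) :
    toEnvelope K (x + y) = toEnvelope K x + toEnvelope K y := by
  rw [toEnvelope, toEnvelope, toEnvelope, ← map_add, ← sub_eq_zero, ← map_sub,
    Envelope.mk_eq_zero]
  refine ⟨Finsupp.single (x + y) 1, Finsupp.single x 1 + Finsupp.single y 1, ?_, fun r => ?_⟩
  · rw [map_add]
    simp only [combCoe_single]
    rfl
  · rw [smul_add, map_add]
    simp only [Finsupp.smul_single, combGerm_single]
    exact smulGerm_add h _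

theorem toEnvelope_smul (r : UnitPart K) (x : A) :
    toEnvelope K (r • x) = (⟨r.1, r.2.1⟩ : K) • toEnvelope K x := by
  rw [toEnvelope, toEnvelope, ← map_smul, ← sub_eq_zero, ← map_sub,
    Envelope.mk_eq_zero]
  refine ⟨Finsupp.single (r • x) 1, Finsupp.single x (NonnegPart.mk ⟨r.1, r.2.1⟩ r.2.2.1), ?_,
    fun s => ?_⟩
  · simp only [combCoe_single, Finsupp.smul_single, smul_eq_mul, mul_one]
    rfl
  · simp only [Finsupp.smul_single, combGerm_single, smul_eq_mul, mul_one]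
    exact smulGerm_smul _ _ _

theorem toEnvelope_zero : toEnvelope K (0 : A) = 0 := by
  have h := toEnvelope_add (K := K) (x := (0 : A)) (y := 0)
    (Le.zero_iff.1 (odot_le_left _ _))
  rwa [add_zero, left_eq_add] at h

theorem toEnvelope_compl (x : A) :
    toEnvelope K xᶜ = toEnvelope K (0 : A)ᶜ - toEnvelope K x := by
  rw [← add_compl_self x, toEnvelope_add (by rw [odot_comm, odot_self_compl]), add_sub_cancel_right]

/-- The cone spanned by the nonzero elements of a scalar MV-algebra. -/
noncomputable def positiveCone (K : Subfield ℝ) (A : Type u) [MVAlgebra A] [ScalarMVAlgebra K A] :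
    ConvexCone K (Envelope K A) where
  carrier := {v | ∃ f : A →₀ NonnegPart K, v = Envelope.mk K A (combCoe K A f) ∧
    ∃ x : A, x ≠ 0 ∧ f x ≠ 0}
  smul_mem' := by
    rintro c hc _ ⟨f, rfl, x, hx, hfx⟩
    refine ⟨NonnegPart.mk c hc.le • f, ?_, x, hx, ?_⟩
    · rw [combCoe_smul, map_smul]
    · rw [Finsupp.smul_apply, smul_eq_mul]
      intro h
      rcases mul_eq_zero.1 (congrArg Subtype.val h : c * (f x).1 = 0) with h | h
      · exact hc.ne' h
      · exact hfx (Subtype.ext h)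
  add_mem' := by
    rintro _ ⟨f, rfl, x, hx, hfx⟩ _ ⟨g, rfl, -⟩
    refine ⟨f + g, by rw [map_add, map_add], x, hx, fun h => hfx (Subtype.ext ?_)⟩
    have h : (f x).1 + (g x).1 = 0 := congrArg Subtype.val h
    exact ((add_eq_zero_iff_of_nonneg (f x).2 (g x).2).1 h).1

theorem toEnvelope_mem_positiveCone {x : A} (hx : x ≠ 0) :
    toEnvelope K x ∈ positiveCone K A := by
  refine ⟨Finsupp.single x 1, by rw [combCoe_single]; rfl, x, hx, ?_⟩
  rw [Finsupp.single_eq_same]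
  exact one_ne_zero

/-- If a nonnegative combination `f` is null, then `f + g' = g` with `g` and `g'` having equal
germs. Cancellation makes the germ of `f` zero, which forces every element in its support to be `0`.
-/
theorem zero_notMem_positiveCone : (0 : Envelope K A) ∉ positiveCone K A := by
  rintro ⟨f, hf, x, hx, hfx⟩
  have hf := Envelope.mk_eq_zero.1 hf.symm
  obtain ⟨g, g', h, h'⟩ := hf
  have h1 : f + g' = g := combCoe_injective (by rw [map_add, h, sub_add_cancel])
  refine hx (eq_zero_of_combGerm_eq_zero (combGerm_eq_zero (g := g') ?_) hfx)
  have h2 := h' 1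
  rw [one_smul, one_smul] at h2
  rw [← map_add, h1, h2]

/-- The filter of functionals on the envelope that are eventually positive at every nonzero
element. -/
noncomputable def positiveFilter (K : Subfield ℝ) (A : Type u) [MVAlgebra A]
    [ScalarMVAlgebra K A] : Filter (Envelope K A →ₗ[K] K) :=
  ⨅ x : {x : A // x ≠ 0}, 𝓟 {φ | 0 < φ (toEnvelope K x.1)}

/-- Gordan's theorem handles finitely many nonzero elements at a time; the filter replaces a single
functional positive on all of them, which need not exist. -/
theorem positiveFilter_neBot : (positiveFilter K A).NeBot := by
  classical
  refine (hasBasis_iInf_principal_finite _).neBot_iff.2 ?_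
  intro t ht
  obtain ⟨φ, hφ⟩ := ConvexCone.exists_dual_pos (positiveCone K A) zero_notMem_positiveCone
    (ht.toFinset.image fun x => toEnvelope K x.1) (by
      intro s hs
      obtain ⟨x, -, rfl⟩ := Finset.mem_image.1 hs
      exact toEnvelope_mem_positiveCone x.2)
  exact ⟨φ, Set.mem_iInter₂.2 fun x hx =>
    hφ _ (Finset.mem_image_of_mem _ (ht.mem_toFinset.2 hx))⟩

theorem eventually_pos {x : A} (hx : x ≠ 0) :
    ∀ᶠ φ in positiveFilter K A, 0 < φ (toEnvelope K x) :=
  mem_iInf_of_mem (⟨x, hx⟩ : {x : A // x ≠ 0}) (mem_principal_self _)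

theorem eventually_nonneg (x : A) : ∀ᶠ φ in positiveFilter K A, 0 ≤ φ (toEnvelope K x) := by
  by_cases hx : x = 0
  · exact Eventually.of_forall fun φ => by rw [hx, toEnvelope_zero, map_zero]
  · exact (eventually_pos hx).mono fun φ h => h.le

end

end ScalarMVAlgebra

/-- Every number in `[0,1] ∩ K` acts on the real unit interval. -/
noncomputable instance UnitPart.scalarMVAlgebraReal {K : Subfield ℝ} :
    ScalarMVAlgebra K RealUnit where
  smul r x := r.scale x
  smul_odot_compl r x y := UnitPart.ext <| by
    change r.1 * (odot x yᶜ).1 = (odot (r.scale x) (r.scale y)ᶜ).1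
    rw [UnitPart.val_odot, UnitPart.val_odot, UnitPart.val_compl, UnitPart.val_compl,
      mul_max_of_nonneg _ _ r.2.2.1]
    change _ = max 0 (r.1 * x.1 + (1 - r.1 * y.1) - 1)
    ring_nf
  odot_compl_smul r q x := UnitPart.ext <| by
    change (odot r qᶜ).1 * x.1 = (odot (r.scale x) (q.scale x)ᶜ).1
    rw [UnitPart.val_odot, UnitPart.val_odot, UnitPart.val_compl, UnitPart.val_compl,
      max_mul_of_nonneg _ _ x.2.2.1]
    change _ = max 0 (r.1 * x.1 + (1 - q.1 * x.1) - 1)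
    ring_nf
  smul_smul' _ _ _ := UnitPart.ext (mul_assoc _ _ _).symm
  one_smul' _ := UnitPart.ext (one_mul _)

theorem UnitPart.val_smul {K : Subfield ℝ} (r : UnitPart K) (x : RealUnit) :
    (r • x).1 = r.1 * x.1 := rfl

/-! ### Approximation of totally ordered algebras by points of `[0,1]` -/

namespace ScalarMVAlgebra

open Filter

variable {K : Subfield ℝ} {A : Type u} [MVAlgebra A] [ScalarMVAlgebra K A]

/-- The value of a functional at an element, normalized at the unit. -/
noncomputable def normalized (φ : Envelope K A →ₗ[K] K) (x : A) : K :=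
  φ (toEnvelope K x) / φ (toEnvelope K (0 : A)ᶜ)

theorem normalized_zero (φ : Envelope K A →ₗ[K] K) : normalized φ 0 = 0 := by
  rw [normalized, toEnvelope_zero, map_zero, zero_div]

theorem normalized_add (φ : Envelope K A →ₗ[K] K) {x y : A} (h : odot x y = 0) :
    normalized φ (x + y) = normalized φ x + normalized φ y := by
  rw [normalized, toEnvelope_add h, map_add, add_div, normalized, normalized]

theorem normalized_smul (φ : Envelope K A →ₗ[K] K) (r : UnitPart K) (x : A) :
    normalized φ (r • x) = ⟨r.1, r.2.1⟩ * normalized φ x := by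
  rw [normalized, toEnvelope_smul, map_smul, smul_eq_mul, mul_div_assoc, normalized]

section

variable (h1 : (0 : A)ᶜ ≠ 0)
include h1

theorem eventually_normalized_pos {x : A} (hx : x ≠ 0) :
    ∀ᶠ φ in positiveFilter K A, 0 < normalized φ x := by
  filter_upwards [eventually_pos hx, eventually_pos h1] with φ h h' using div_pos h h'

theorem eventually_normalized_nonneg (x : A) :
    ∀ᶠ φ in positiveFilter K A, 0 ≤ normalized φ x := by
  filter_upwards [eventually_nonneg x, eventually_pos h1] with φ h h' using div_nonneg h h'.le

theorem eventually_normalized_compl :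
    ∀ᶠ φ in positiveFilter K A, ∀ x : A, normalized φ xᶜ = 1 - normalized φ x := by
  filter_upwards [eventually_pos h1] with φ h x
  rw [normalized, toEnvelope_compl, map_sub, sub_div, div_self h.ne', normalized]

theorem eventually_normalized_le_one (x : A) :
    ∀ᶠ φ in positiveFilter K A, normalized φ x ≤ 1 := by
  filter_upwards [eventually_normalized_nonneg h1 xᶜ, eventually_normalized_compl h1] with φ h h'
  rw [h'] at h
  exact sub_nonneg.1 h

/-- In a totally ordered algebra functionals eventually turn `⊕` into the truncated addition. -/
theorem eventually_normalized_add (htot : ∀ x y : A, Le x y ∨ Le y x) (x y : A) :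
    ∀ᶠ φ in positiveFilter K A, normalized φ (x + y) = min 1 (normalized φ x + normalized φ y) := by
  -- Total order leaves two cases: the sum overflows to `1`, or it is disjoint.
  rcases htot xᶜ y with h | h
  · filter_upwards [eventually_normalized_compl h1, eventually_normalized_nonneg h1 (odot y x)]
      with φ hc hn
    have hxy : x + y = (0 : A)ᶜ := by
      have h2 : xᶜᶜ + y = (0 : A)ᶜ := h
      rwa [compl_compl'] at h2
    -- The excess `y ⊙ x` over `x*` has nonnegative value, so the values of `x` and `y` add up to at
    -- least `1`.
    have hy : y = xᶜ + odot y x := by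
      have h2 := add_odot_compl h
      rw [compl_compl'] at h2
      exact h2.symm
    have hd : odot xᶜ (odot y x) = 0 := by
      rw [odot_comm y, ← odot_assoc, odot_comm xᶜ, odot_self_compl]
      exact Le.zero_iff.1 (odot_le_left _ _)
    have h2 : normalized φ y = 1 - normalized φ x + normalized φ (odot y x) := by
      conv_lhs => rw [hy]
      rw [normalized_add φ hd, hc]
    rw [hxy, hc, normalized_zero, sub_zero, eq_comm, min_eq_left]
    linarith
  · filter_upwards [eventually_normalized_le_one h1 (x + y)] with φ hle
    have h2 : odot x y = 0 := by rw [odot_comm]; exact odot_eq_zero_iff.2 h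
    rw [normalized_add φ h2] at hle ⊢
    rw [min_eq_right hle]

end

/-- The point of a real cube given by a functional on the envelope. -/
noncomputable def realPoint {X : Type v} (φ : Envelope K A →ₗ[K] K) (x : X → A) (i : X) :
    RealUnit :=
  ⟨(UnitPart.clamp (normalized φ (x i))).1, Subfield.mem_top _,
    (UnitPart.clamp (normalized φ (x i))).2.2⟩

/-- A term involves finitely many operations, so finitely many eventual conditions suffice. Under
them the clamping of its variables is inactive and each operation is the one of `[0,1]`. -/
theorem eventually_eval {X : Type v} (h1 : (0 : A)ᶜ ≠ 0) (htot : ∀ x y : A, Le x y ∨ Le y x)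
    (x : X → A) (t : ScalarMVTerm K X) :
    ∀ᶠ φ in positiveFilter K A,
      (ScalarMVTerm.eval (realPoint φ x) t).1 = normalized φ (ScalarMVTerm.eval x t) := by
  induction t with
  | var i =>
    filter_upwards [eventually_normalized_nonneg h1 (x i), eventually_normalized_le_one h1 (x i)]
      with φ h h' using UnitPart.val_clamp h h'
  | zero =>
    refine Eventually.of_forall fun φ => ?_
    simp only [ScalarMVTerm.eval]
    rw [normalized_zero, UnitPart.val_zero]
    rfl
  | oplus s t hs ht =>
    filter_upwards [hs, ht, eventually_normalized_add h1 htot (ScalarMVTerm.eval x s)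
      (ScalarMVTerm.eval x t)] with φ hs ht h
    simp only [ScalarMVTerm.eval]
    rw [h, UnitPart.val_add, hs, ht]
    generalize normalized φ (ScalarMVTerm.eval x s) = a
    generalize normalized φ (ScalarMVTerm.eval x t) = b
    have hm : Monotone (Subtype.val : K → ℝ) := fun _ _ h => h
    exact (hm.map_min (a := 1) (b := a + b)).symm
  | neg t ht =>
    filter_upwards [ht, eventually_normalized_compl h1] with φ ht h
    simp only [ScalarMVTerm.eval]
    rw [h, UnitPart.val_compl, ht]
    rfl
  | scale r t ht =>
    filter_upwards [ht] with φ ht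
    simp only [ScalarMVTerm.eval]
    rw [normalized_smul, UnitPart.val_smul, ht]
    rfl

end ScalarMVAlgebra

/-! ### The Nullstellensatz -/

namespace FreeScalarMV

open ScalarMVAlgebra

variable {K : Subfield ℝ} {X : Type u}

/-- The class of a term. -/
def mk (t : ScalarMVTerm K X) : FreeScalarMV K X := Quotient.mk _ t

theorem cls_mk_eq_eval (J : MVIdeal (FreeScalarMV K X)) (t : ScalarMVTerm K X) :
    J.cls (mk t) = ScalarMVTerm.eval (fun i => J.cls (of i)) t := by
  induction t with
  | var i => rfl
  | zero => rfl
  | oplus s t hs ht => simp only [ScalarMVTerm.eval, ← hs, ← ht]; rfl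
  | neg t ht => simp only [ScalarMVTerm.eval, ← ht]; rfl
  | scale r t ht => simp only [ScalarMVTerm.eval, ← ht]; rfl

/-- Nullstellensatz: in a free Riesz MV-algebra (DMV-algebra), an element that vanishes at the real
zeros of `u` belongs to the ideal of `u`. -/
theorem mem_span_of_eval_eq_zero (t u : ScalarMVTerm K X)
    (h : ∀ x : X → RealUnit, ScalarMVTerm.eval x u = 0 → ScalarMVTerm.eval x t = 0) :
    mk t ∈ (MVIdeal.span {mk u}).carrier := by
  by_contra ht
  obtain ⟨I, hI, htI, htot⟩ := MVIdeal.exists_total _ ht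
  have hu0 := I.cls_eq_zero.2 (hI (MVIdeal.subset_span _ rfl))
  have ht0 := mt I.cls_eq_zero.1 htI
  rw [cls_mk_eq_eval] at hu0 ht0
  have h1 : (0 : I.Quotient)ᶜ ≠ 0 := fun h0 =>
    ht0 (Le.zero_iff.1 (h0 ▸ Le.le_one _))
  have := positiveFilter_neBot (K := K) (A := I.Quotient)
  -- One functional serves for `u`, for `t` and for the positivity of the class of `t`; its point is
  -- a real zero of `u` at which `t` is positive.
  obtain ⟨φ, hφu, hφt, hφ⟩ := ((eventually_eval h1 htot _ u).and
    ((eventually_eval h1 htot _ t).and (eventually_normalized_pos h1 ht0))).exists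
  rw [hu0, normalized_zero] at hφu
  have h2 := h _ (UnitPart.ext hφu)
  rw [h2] at hφt
  exact hφ.ne (Subtype.ext hφt)

end FreeScalarMV

/-! ## Homomorphisms and ideals -/

/-- The zero ideal. -/
instance {A : Type u} [MVAlgebra A] : Bot (MVIdeal A) where
  bot :=
    { carrier := {0}
      zero_mem := rfl
      add_mem := by rintro _ _ rfl rfl; exact add_zero _
      lower := by rintro x _ h rfl; exact Le.zero_iff.1 h }

namespace MVHom

variable {A : Type u} {B : Type v} {C : Type w} [MVAlgebra A] [MVAlgebra B] [MVAlgebra C]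

theorem apply_chang (φ : MVHom A B) (x y : A) : φ (chang x y) = chang (φ x) (φ y) := by
  simp only [chang, apply_add, apply_odot, apply_compl]

theorem apply_le (φ : MVHom A B) {x y : A} (h : Le x y) : Le (φ x) (φ y) := by
  rw [Le, ← apply_compl, ← apply_add, show xᶜ + y = _ from h, apply_compl, apply_zero]

/-- Composition of homomorphisms. -/
def comp (ψ : MVHom B C) (φ : MVHom A B) : MVHom A C where
  toFun x := ψ (φ x)
  map_zero' := by rw [apply_zero, apply_zero]
  map_add' x y := by rw [apply_add, apply_add]
  map_compl' x := by rw [apply_compl, apply_compl]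

theorem comp_apply (ψ : MVHom B C) (φ : MVHom A B) (x : A) : ψ.comp φ x = ψ (φ x) := rfl

/-- The identity homomorphism. -/
def id (A : Type u) [MVAlgebra A] : MVHom A A where
  toFun x := x
  map_zero' := rfl
  map_add' _ _ := rfl
  map_compl' _ := rfl

/-- The preimage of an ideal. -/
def comap (φ : MVHom A B) (J : MVIdeal B) : MVIdeal A where
  carrier := {x | φ x ∈ J.carrier}
  zero_mem := by
    change φ 0 ∈ J.carrier
    rw [φ.apply_zero]
    exact J.zero_mem
  add_mem {x y} hx hy := by
    change φ (x + y) ∈ J.carrier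
    rw [φ.apply_add]
    exact J.add_mem hx hy
  lower h hy := J.lower (φ.apply_le h) hy

theorem mem_of_mem_span (φ : MVHom A B) {S : Set A} {J : MVIdeal B}
    (h : ∀ x ∈ S, φ x ∈ J.carrier) {x : A} (hx : x ∈ (MVIdeal.span S).carrier) :
    φ x ∈ J.carrier :=
  hx (φ.comap J) h

theorem eq_of_chang (φ : MVHom A B) {x y : A} (h : φ (chang x y) = 0) : φ x = φ y :=
  eq_of_chang_eq_zero (by rw [← apply_chang, h])

theorem apply_chang_eq_zero (φ : MVHom A B) {x y : A} (h : φ x = φ y) : φ (chang x y) = 0 := by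
  rw [apply_chang, h, chang_self]

/-- A homomorphism that vanishes on the kernel of a surjection factors through it. -/
theorem exists_factor (φ : MVHom A B) (hφ : ∀ b, ∃ a, φ a = b) (ψ : MVHom A C)
    (h : ∀ x, φ x = 0 → ψ x = 0) : ∃ χ : MVHom B C, ∀ x, χ (φ x) = ψ x := by
  choose s hs using hφ
  have key : ∀ x, ψ (s (φ x)) = ψ x := fun x =>
    ψ.eq_of_chang (h _ (φ.apply_chang_eq_zero (hs (φ x))))
  refine ⟨⟨⟨⟨fun b => ψ (s b), ?_⟩, fun a b => ?_⟩, fun b => ?_⟩, key⟩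
  · have := key 0
    rwa [φ.apply_zero, ψ.apply_zero] at this
  · have := key (s a + s b)
    rwa [φ.apply_add, hs, hs, ψ.apply_add] at this
  · have := key (s b)ᶜ
    rwa [φ.apply_compl, hs, ψ.apply_compl] at this

/-- Two surjections with the same kernel have isomorphic images. -/
theorem exists_equiv (φ : MVHom A B) (hφ : ∀ b, ∃ a, φ a = b) (ψ : MVHom A C)
    (hψ : ∀ c, ∃ a, ψ a = c) (h : ∀ x, φ x = 0 ↔ ψ x = 0) :
    ∃ e : MVEquiv B C, ∀ x, e (φ x) = ψ x := by
  obtain ⟨χ, hχ⟩ := φ.exists_factor hφ ψ fun x => (h x).1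
  have hbij : Function.Bijective χ.toAddMonoidHom := by
    constructor
    · intro b b' hb
      obtain ⟨a, rfl⟩ := hφ b
      obtain ⟨a', rfl⟩ := hφ b'
      refine φ.eq_of_chang ((h _).2 (ψ.apply_chang_eq_zero ?_))
      rw [← hχ, ← hχ]
      exact hb
    · intro c
      obtain ⟨a, rfl⟩ := hψ c
      exact ⟨φ a, hχ a⟩
  exact ⟨⟨AddEquiv.ofBijective χ.toAddMonoidHom hbij, χ.map_compl'⟩, hχ⟩

end MVHom

/-- The canonical homomorphism onto a quotient. -/
def MVIdeal.clsHom {A : Type u} [MVAlgebra A] (J : MVIdeal A) : MVHom A J.Quotient where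
  toFun := J.cls
  map_zero' := rfl
  map_add' _ _ := rfl
  map_compl' _ := rfl

theorem MVIdeal.clsHom_surjective {A : Type u} [MVAlgebra A] (J : MVIdeal A) (y : J.Quotient) :
    ∃ x, J.clsHom x = y := by
  obtain ⟨x⟩ := y
  exact ⟨x, rfl⟩

/-- A presentation of an MV-algebra from an isomorphism with a quotient. -/
theorem MVEquiv.exists_presentation {A : Type u} {M : Type v} [MVAlgebra A] [MVAlgebra M]
    {J : MVIdeal M} (e : MVEquiv A J.Quotient) :
    ∃ q : MVHom M A, (∀ a, ∃ f, q f = a) ∧ ∀ f, q f = 0 ↔ f ∈ J.carrier := by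
  have he : ∀ y, e.toAddEquiv (e.toAddEquiv.symm y) = y := e.toAddEquiv.apply_symm_apply
  let s : MVHom J.Quotient A :=
    ⟨e.toAddEquiv.symm.toAddMonoidHom, fun y => e.toAddEquiv.injective (by
      change e.toAddEquiv (e.toAddEquiv.symm yᶜ) = e.toFun (e.toAddEquiv.symm y)ᶜ
      rw [e.map_compl']
      change _ = (e.toAddEquiv (e.toAddEquiv.symm y))ᶜ
      rw [he, he])⟩
  refine ⟨s.comp J.clsHom, fun a => ?_, fun f => ?_⟩
  · obtain ⟨f, hf⟩ := J.clsHom_surjective (e.toAddEquiv a)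
    refine ⟨f, ?_⟩
    rw [MVHom.comp_apply, hf]
    exact e.toAddEquiv.symm_apply_apply a
  · rw [← J.cls_eq_zero]
    exact e.toAddEquiv.symm.map_eq_zero_iff

/-! ## Free algebras -/

namespace FreeMV

variable {X : Type u} {A : Type v} [MVAlgebra A]

/-- The class of a term. -/
def mk (t : MVTerm X) : FreeMV X := Quotient.mk _ t

theorem apply_mk (φ : MVHom (FreeMV X) A) (t : MVTerm X) :
    φ (mk t) = MVTerm.eval (fun i => φ (of i)) t := by
  induction t with
  | var i => rfl
  | zero => exact φ.apply_zero
  | oplus s t hs ht => simp only [MVTerm.eval, ← hs, ← ht]; exact φ.apply_add (mk s) (mk t)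
  | neg t ht => simp only [MVTerm.eval, ← ht]; exact φ.apply_compl (mk t)

theorem hom_ext {φ ψ : MVHom (FreeMV X) A} (h : ∀ i, φ (of i) = ψ (of i)) (f : FreeMV X) :
    φ f = ψ f := by
  obtain ⟨t⟩ := f
  change φ (mk t) = ψ (mk t)
  rw [apply_mk, apply_mk, funext h]

/-- If a finitely generated algebra has a presentation by a principal ideal, then the kernel of
every presentation with finitely many generators is principal. -/
theorem exists_ker_eq_span {Y : Type w} [Fintype X] (q : MVHom (FreeMV X) A)
    (hq : ∀ a, ∃ f, q f = a) (p : MVHom (FreeMV Y) A) (hp : ∀ a, ∃ f, p f = a) (a : FreeMV Y)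
    (ha : ∀ f, p f = 0 ↔ f ∈ (MVIdeal.span {a}).carrier) :
    ∃ b : FreeMV X, ∀ f, q f = 0 ↔ f ∈ (MVIdeal.span {b}).carrier := by
  classical
  choose s hs using fun i : X => hp (q (of i))
  choose t ht using fun j : Y => hq (p (of j))
  obtain ⟨l, hl, -⟩ := existsUnique_hom t
  have hql : ∀ f, q (l f) = p f :=
    hom_ext (φ := q.comp l) fun j => by rw [MVHom.comp_apply, hl, ht]
  -- A Tietze transformation: `l a` is the old relation in the new generators, and each distance
  -- expresses that `x_i` equals its old description `s i` translated back.
  let b : FreeMV X := l a + ∑ i, chang (of i) (l (s i))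
  have hqb : q b = 0 := by
    change q (l a + ∑ i, chang (of i) (l (s i))) = 0
    rw [q.apply_add, hql, (ha a).2 (MVIdeal.subset_span _ rfl), zero_add]
    change q.toAddMonoidHom _ = 0
    rw [map_sum]
    refine Finset.sum_eq_zero fun i _ => q.apply_chang_eq_zero ?_
    rw [hql, hs]
  refine ⟨b, fun f => ⟨fun hf => ?_, fun hf => ?_⟩⟩
  · let I := MVIdeal.span {b}
    have hb : b ∈ I.carrier := MVIdeal.subset_span _ rfl
    -- Modulo `b` the relation `a` holds, so translation by `l` descends to a map from `A` to the
    -- quotient by `b`.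
    obtain ⟨χ, hχ⟩ := p.exists_factor hp (I.clsHom.comp l) (by
      intro g hg
      refine I.cls_eq_zero.2 (l.mem_of_mem_span ?_ ((ha g).1 hg))
      rintro _ rfl
      exact I.lower (le_add_right _ _) hb)
    -- It suffices to check generators, where the distance of `x_i` to `l (s i)` is a summand of
    -- `b`. Consequently the kernel of `q` lies in the ideal of `b`.
    have hcls : ∀ g, χ (q g) = I.clsHom g := by
      refine hom_ext (φ := χ.comp q) fun i => ?_
      rw [MVHom.comp_apply, ← hs, hχ, MVHom.comp_apply]
      refine ((I.cls_eq).2 (I.lower ?_ hb)).symm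
      refine Le.trans (le_iff_exists.2 ?_) (le_add_left _ _)
      exact ⟨_, (Finset.add_sum_erase _ _ (Finset.mem_univ i)).symm⟩
    refine I.cls_eq_zero.1 ?_
    change I.clsHom f = 0
    rw [← hcls, hf, χ.apply_zero]
  · refine q.mem_of_mem_span (J := ⊥) ?_ hf
    rintro _ rfl
    exact hqb

end FreeMV

/-- An MV-term as a term in the language with scalars. -/
def MVTerm.toScalar (K : Subfield ℝ) {X : Type u} : MVTerm X → ScalarMVTerm K X
  | var i => .var i
  | zero => .zero
  | oplus s t => .oplus (toScalar K s) (toScalar K t)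
  | neg t => .neg (toScalar K t)

theorem MVTerm.eval_toScalar {K : Subfield ℝ} {X : Type u} {A : Type v} [MVAlgebra A]
    [ScalarMVAlgebra K A] (x : X → A) (t : MVTerm X) :
    ScalarMVTerm.eval x (t.toScalar K) = t.eval x := by
  induction t with
  | var i => rfl
  | zero => rfl
  | oplus s t hs ht => simp only [MVTerm.eval, ← hs, ← ht]; rfl
  | neg t ht => simp only [MVTerm.eval, ← ht]; rfl

theorem ScalarMVTerm.apply_eval {K : Subfield ℝ} {X : Type u} {A : Type v} {B : Type w}
    [MVAlgebra A] [ScalarMVAlgebra K A] [MVAlgebra B] [ScalarMVAlgebra K B] (φ : MVHom A B)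
    (hφ : ∀ (r : UnitPart K) x, φ (r • x) = r • φ x) (x : X → A) (t : ScalarMVTerm K X) :
    φ (t.eval x) = t.eval fun i => φ (x i) := by
  induction t with
  | var i => rfl
  | zero => exact φ.apply_zero
  | oplus s t hs ht => simp only [eval, ← hs, ← ht]; exact φ.apply_add _ _
  | neg t ht => simp only [eval, ← ht]; exact φ.apply_compl _
  | scale r t ht => simp only [eval, ← ht]; exact hφ _ _

namespace FreeScalarMV

variable {K : Subfield ℝ} {X : Type u} {A : Type v} [MVAlgebra A] [ScalarMVAlgebra K A]

/-- The homomorphism of a free algebra given by the images of the generators. -/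
def lift (x : X → A) : MVHom (FreeScalarMV K X) A where
  toFun := Quotient.lift (ScalarMVTerm.eval x) fun _ _ h => ScalarMVTerm.eval_eq x h
  map_zero' := rfl
  map_add' := by rintro ⟨s⟩ ⟨t⟩; rfl
  map_compl' := by rintro ⟨t⟩; rfl

theorem lift_mk (x : X → A) (t : ScalarMVTerm K X) : lift x (mk t) = t.eval x := rfl

theorem lift_smul (x : X → A) (r : UnitPart K) (f : FreeScalarMV K X) :
    lift x (r • f) = r • lift x f := by
  obtain ⟨t⟩ := f
  rfl

end FreeScalarMV

/-! ## Bimorphisms of `([0,1] ∩ K) × A` into `[0,1]` -/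

section

variable {K : Subfield ℝ} {A : Type u} [MVAlgebra A]

theorem MVBimorphism.ext {B : Type v} {C : Type w} [MVAlgebra B] [MVAlgebra C]
    {β γ : MVBimorphism A B C} (h : ∀ a b, β a b = γ a b) : β = γ := by
  have h' : β.toFun = γ.toFun := funext fun a => funext fun b => h a b
  cases β
  cases γ
  cases h'
  rfl

/-- The homomorphism `a ↦ β(1, a)`. -/
noncomputable def MVBimorphism.hom (β : MVBimorphism (UnitPart K) A RealUnit) : MVHom A RealUnit where
  toFun a := β (0 : UnitPart K)ᶜ a
  map_zero' := β.map_zero_right _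
  map_compl' a := by
    have h0 : odot a aᶜ = 0 := odot_self_compl a
    have h1 := β.map_add_right (0 : UnitPart K)ᶜ a aᶜ h0
    have h2 := UnitPart.odot_eq_zero_iff.1 (β.odot_right (0 : UnitPart K)ᶜ a aᶜ h0)
    rw [add_comm a, add_compl_self, β.map_one_one] at h1
    have h3 := congrArg Subtype.val h1
    rw [UnitPart.val_add_of_le h2, ← UnitPart.one_eq, UnitPart.val_one] at h3
    refine UnitPart.ext ?_
    rw [UnitPart.val_compl]
    linarith
  map_add' a b := by
    have h0 : odot a aᶜ = 0 := odot_self_compl a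
    have hd : odot a (meet b aᶜ) = 0 := by
      rw [← Le.zero_iff, ← h0]
      exact (Le.refl a).odot (meet_le_right _ _)
    have h1 := β.map_add_right (0 : UnitPart K)ᶜ a aᶜ h0
    have h2 := UnitPart.odot_eq_zero_iff.1 (β.odot_right (0 : UnitPart K)ᶜ a aᶜ h0)
    rw [add_comm a, add_compl_self, β.map_one_one] at h1
    have h3 := congrArg Subtype.val h1
    rw [UnitPart.val_add_of_le h2, ← UnitPart.one_eq, UnitPart.val_one] at h3
    have h4 : (β (0 : UnitPart K)ᶜ a)ᶜ = β (0 : UnitPart K)ᶜ aᶜ := by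
      refine UnitPart.ext ?_
      rw [UnitPart.val_compl]
      linarith
    rw [← add_meet_compl a b, β.map_add_right _ _ _ hd, β.map_meet_right, ← h4, add_meet_compl]

/-- For fixed `a` the value is additive and nonnegative in the scalar, hence linear
(`UnitPart.linear_of_additive`). -/
theorem MVBimorphism.apply_eq_smul (β : MVBimorphism (UnitPart K) A RealUnit) (r : UnitPart K)
    (a : A) : β r a = r • β.hom a := by
  refine UnitPart.ext ?_
  have h := β.val_mul_left r 1 a
  rw [show r * 1 = r from UnitPart.ext (mul_one _), UnitPart.one_eq] at h
  exact h

theorem UnitPart.val_smul_join (r : UnitPart K) (x y : RealUnit) :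
    r • join x y = join (r • x) (r • y) := UnitPart.ext <| by
  rw [val_join, val_smul, val_smul, val_smul, val_join, mul_max_of_nonneg _ _ r.2.2.1]

theorem UnitPart.val_smul_meet (r : UnitPart K) (x y : RealUnit) :
    r • meet x y = meet (r • x) (r • y) := UnitPart.ext <| by
  rw [val_meet, val_smul, val_smul, val_smul, val_meet, mul_min_of_nonneg _ _ r.2.2.1]

/-- The bimorphism `(r, a) ↦ r h(a)`. -/
noncomputable def MVHom.scalarBimorphism (K : Subfield ℝ) (h : MVHom A RealUnit) :
    MVBimorphism (UnitPart K) A RealUnit where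
  toFun r a := r • h a
  map_one_one := by
    rw [← UnitPart.one_eq (K := K), ScalarMVAlgebra.one_smul', h.apply_compl, h.apply_zero]
  map_zero_left b := ScalarMVAlgebra.zero_smul' _
  map_zero_right r := by rw [h.apply_zero, ScalarMVAlgebra.smul_zero']
  map_join_left r s a := UnitPart.ext <| by
    rw [UnitPart.val_join, UnitPart.val_smul, UnitPart.val_smul, UnitPart.val_smul,
      UnitPart.val_join, max_mul_of_nonneg _ _ (h a).2.2.1]
  map_join_right r a b := by rw [h.apply_join, UnitPart.val_smul_join]
  map_meet_left r s a := UnitPart.ext <| by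
    rw [UnitPart.val_meet, UnitPart.val_smul, UnitPart.val_smul, UnitPart.val_smul,
      UnitPart.val_meet, min_mul_of_nonneg _ _ (h a).2.2.1]
  map_meet_right r a b := by rw [h.apply_meet, UnitPart.val_smul_meet]
  odot_left r s a hrs := ScalarMVAlgebra.odot_smul hrs _
  odot_right r a b hab := by
    have h0 : odot (h a) (h b) = 0 := by rw [← h.apply_odot, hab, h.apply_zero]
    rw [← Le.zero_iff, ← h0]
    exact (ScalarMVAlgebra.smul_le _ _).odot (ScalarMVAlgebra.smul_le _ _)
  map_add_left r s a hrs := ScalarMVAlgebra.add_smul_of_odot hrs _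
  map_add_right r a b hab := by
    rw [h.apply_add]
    exact ScalarMVAlgebra.smul_add_of_odot r (by rw [← h.apply_odot, hab, h.apply_zero])

end

/-! ### Tensor products as images of free algebras with scalars -/

namespace SemisimpleTensor

variable {K : Subfield ℝ} {A : Type u} [MVAlgebra A]

/-- The homomorphism `([0,1] ∩ K) ⊗ A → [0,1]`, `r ⊗ a ↦ r h(a)`. -/
noncomputable def evalAt (h : MVHom A RealUnit) : MVHom (SemisimpleTensor (UnitPart K) A) RealUnit :=
  evalHom (h.scalarBimorphism K)

theorem evalAt_tmul (h : MVHom A RealUnit) (r : UnitPart K) (a : A) :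
    evalAt h (tmul r a) = r • h a := rfl

theorem evalAt_incl (h : MVHom A RealUnit) (a : A) :
    evalAt h (incl a : SemisimpleTensor (UnitPart K) A) = h a := by
  rw [incl, evalAt_tmul, ← UnitPart.one_eq, ScalarMVAlgebra.one_smul']

theorem evalAt_smul (h : MVHom A RealUnit) (r : UnitPart K)
    (t : SemisimpleTensor (UnitPart K) A) : evalAt h (r • t) = r • evalAt h t := rfl

/-- Every bimorphism into `[0,1]` comes from a homomorphism of `A`, so the tensor product is an
algebra of functions on the homomorphisms `A → [0,1]`. -/
theorem ext_evalAt {s t : SemisimpleTensor (UnitPart K) A} (H : ∀ h, evalAt h s = evalAt h t) :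
    s = t := by
  refine ext_evalHom fun β => ?_
  have hβ : β = β.hom.scalarBimorphism K := MVBimorphism.ext β.apply_eq_smul
  rw [hβ]
  exact H _

/-- The homomorphism `ι(a) = 1 ⊗ a`. -/
noncomputable def inclHom (K : Subfield ℝ) (A : Type u) [MVAlgebra A] :
    MVHom A (SemisimpleTensor (UnitPart K) A) where
  toFun := incl
  map_zero' := ext_evalAt fun h => by rw [evalAt_incl, h.apply_zero, MVHom.apply_zero]
  map_add' a b := ext_evalAt fun h => by
    rw [MVHom.apply_add, evalAt_incl, evalAt_incl, evalAt_incl, h.apply_add]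
  map_compl' a := ext_evalAt fun h => by
    rw [MVHom.apply_compl, evalAt_incl, evalAt_incl, h.apply_compl]

theorem smul_incl (r : UnitPart K) (a : A) :
    r • (incl a : SemisimpleTensor (UnitPart K) A) = tmul r a := by
  rw [incl, smul_tmul, show r * (0 : UnitPart K)ᶜ = r from by
    rw [← UnitPart.one_eq]; exact UnitPart.ext (mul_one _)]

variable {X : Type v}

/-- The homomorphism from the free algebra with scalars to `([0,1] ∩ K) ⊗ A` induced by a
homomorphism from the free MV-algebra to `A`. -/
noncomputable def freeMap (K : Subfield ℝ) (q : MVHom (FreeMV X) A) :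
    MVHom (FreeScalarMV K X) (SemisimpleTensor (UnitPart K) A) :=
  FreeScalarMV.lift fun i => incl (q (FreeMV.of i))

theorem freeMap_smul (q : MVHom (FreeMV X) A) (r : UnitPart K) (f : FreeScalarMV K X) :
    freeMap K q (r • f) = r • freeMap K q f := FreeScalarMV.lift_smul _ _ _

theorem freeMap_toScalar (q : MVHom (FreeMV X) A) (t : MVTerm X) :
    freeMap K q (FreeScalarMV.mk (t.toScalar K)) = incl (q (FreeMV.mk t)) := by
  rw [freeMap, FreeScalarMV.lift_mk, MVTerm.eval_toScalar]
  exact (FreeMV.apply_mk ((inclHom K A).comp q) t).symm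

theorem evalAt_freeMap (q : MVHom (FreeMV X) A) (h : MVHom A RealUnit) (t : ScalarMVTerm K X) :
    evalAt h (freeMap K q (FreeScalarMV.mk t)) = t.eval fun i => h (q (FreeMV.of i)) := by
  rw [freeMap, FreeScalarMV.lift_mk, ScalarMVTerm.apply_eval _ (evalAt_smul h)]
  simp only [evalAt_incl]

theorem freeMap_surjective (q : MVHom (FreeMV X) A) (hq : ∀ a, ∃ f, q f = a)
    (y : SemisimpleTensor (UnitPart K) A) : ∃ f, freeMap K q f = y := by
  induction y using induction with
  | tm r a =>
    obtain ⟨⟨t⟩, rfl⟩ := hq a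
    refine ⟨r • FreeScalarMV.mk (t.toScalar K), ?_⟩
    rw [freeMap_smul, freeMap_toScalar, smul_incl]
    rfl
  | zero => exact ⟨0, MVHom.apply_zero _⟩
  | oplus s t hs ht =>
    obtain ⟨f, rfl⟩ := hs
    obtain ⟨g, rfl⟩ := ht
    exact ⟨f + g, MVHom.apply_add _ _ _⟩
  | neg t ht =>
    obtain ⟨f, rfl⟩ := ht
    exact ⟨fᶜ, MVHom.apply_compl _ _⟩

/-- Real zeros of `u` give homomorphisms `A → [0,1]`, and an element of the kernel vanishes at all
of them, so the Nullstellensatz applies. The converse holds because `u` maps to `1 ⊗ 0`. -/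
theorem freeMap_eq_zero_iff (q : MVHom (FreeMV X) A) (hq : ∀ a, ∃ f, q f = a) (u : MVTerm X)
    (hu : ∀ f, q f = 0 ↔ f ∈ (MVIdeal.span {FreeMV.mk u}).carrier) (f : FreeScalarMV K X) :
    freeMap K q f = 0 ↔
      f ∈ (MVIdeal.span {FreeScalarMV.mk (u.toScalar K)}).carrier := by
  constructor
  · obtain ⟨t⟩ := f
    intro ht
    refine FreeScalarMV.mem_span_of_eval_eq_zero t _ fun x hx => ?_
    rw [MVTerm.eval_toScalar] at hx
    obtain ⟨p, hp, -⟩ := FreeMV.existsUnique_hom x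
    -- Evaluation at a zero of `u` kills the ideal of `u`, which is the kernel of `q`, so it factors
    -- through `A`.
    obtain ⟨h, hh⟩ := q.exists_factor hq p (by
      intro g hg
      refine p.mem_of_mem_span (J := ⊥) ?_ ((hu g).1 hg)
      rintro _ rfl
      change p (FreeMV.mk u) = 0
      rw [FreeMV.apply_mk, funext hp, hx])
    have h1 := evalAt_freeMap q h t
    simp only [hh, hp] at h1
    rw [← h1]
    change evalAt h (freeMap K q (FreeScalarMV.mk t)) = 0
    rw [show freeMap K q (FreeScalarMV.mk t) = 0 from ht, MVHom.apply_zero]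
  · intro hf
    refine (freeMap K q).mem_of_mem_span (J := ⊥) ?_ hf
    rintro _ rfl
    change freeMap K q _ = 0
    rw [freeMap_toScalar, (hu _).2 (MVIdeal.subset_span _ rfl)]
    exact (inclHom K A).apply_zero

end SemisimpleTensor

/-! ### Comparison of kernels and finite presentations -/

namespace SemisimpleTensor

variable {K : Subfield ℝ}

theorem freeMap_id_surjective {X : Type u} (y : SemisimpleTensor (UnitPart K) (FreeMV X)) :
    ∃ f, freeMap K (MVHom.id (FreeMV X)) f = y :=
  freeMap_surjective _ (fun f => ⟨f, rfl⟩) y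

/-- Tensoring with `[0,1] ∩ K` commutes with the quotient by a principal ideal. -/
theorem exists_quotient_equiv {X : Type u} (J : MVIdeal (FreeMV X)) (u : MVTerm X)
    (hJ : ∀ f, f ∈ J.carrier ↔ f ∈ (MVIdeal.span {FreeMV.mk u}).carrier) :
    ∃ e : MVEquiv (SemisimpleTensor (UnitPart K) J.Quotient)
        (MVIdeal.span ((incl : FreeMV X → SemisimpleTensor (UnitPart K) (FreeMV X)) ''
          J.carrier)).Quotient,
      (∀ (α : UnitPart K) (f : FreeMV X),
        e (tmul α (J.cls f)) = MVIdeal.cls _ (tmul α f)) ∧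
      ∀ (r : UnitPart K) (x : SemisimpleTensor (UnitPart K) J.Quotient), e (r • x) = r • e x := by
  have hq : ∀ a, ∃ f, J.clsHom f = a := J.clsHom_surjective
  have hker : ∀ f, J.clsHom f = 0 ↔ f ∈ (MVIdeal.span {FreeMV.mk u}).carrier := fun f =>
    J.cls_eq_zero.trans (hJ f)
  let I := MVIdeal.span ((incl : FreeMV X → SemisimpleTensor (UnitPart K) (FreeMV X)) '' J.carrier)
  let F := freeMap K (MVHom.id (FreeMV X))
  obtain ⟨e, he⟩ := (freeMap K J.clsHom).exists_equiv (freeMap_surjective _ hq) (I.clsHom.comp F)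
    (by
      intro c
      obtain ⟨y, rfl⟩ := I.clsHom_surjective c
      obtain ⟨f, rfl⟩ := freeMap_id_surjective y
      exact ⟨f, rfl⟩)
    (by
      intro f
      refine Iff.trans ?_ I.cls_eq_zero.symm
      constructor
      · intro hf
        -- The first kernel is generated by `u`, and `F` sends `u` to `ι(u)` with `u` in `J`.
        refine F.mem_of_mem_span ?_ ((freeMap_eq_zero_iff _ hq u hker f).1 hf)
        rintro _ rfl
        change freeMap K (MVHom.id (FreeMV X)) _ ∈ _
        rw [freeMap_toScalar]
        exact MVIdeal.subset_span _ ⟨_, (hJ _).2 (MVIdeal.subset_span _ rfl), rfl⟩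
      · intro hf
        refine ext_evalAt fun h => ?_
        rw [MVHom.apply_zero]
        -- A homomorphism `h` of the quotient, pulled back along `J.clsHom`, kills `ι(J)`. The two
        -- evaluations then agree because they use the same images of the generators.
        have h1 : evalAt (h.comp J.clsHom) (F f) = 0 := by
          refine MVHom.mem_of_mem_span (J := ⊥) _ ?_ hf
          rintro _ ⟨g, hg, rfl⟩
          change evalAt (h.comp J.clsHom) (incl g) = 0
          rw [evalAt_incl, MVHom.comp_apply, show J.clsHom g = 0 from J.cls_eq_zero.2 hg,
            h.apply_zero]
        obtain ⟨t⟩ := f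
        rw [← h1]
        exact (evalAt_freeMap J.clsHom h t).trans
          (evalAt_freeMap (MVHom.id _) (h.comp J.clsHom) t).symm)
  have he' : ∀ (r : UnitPart K) (x : SemisimpleTensor (UnitPart K) J.Quotient),
      e (r • x) = r • e x := by
    intro r x
    obtain ⟨f, rfl⟩ := freeMap_surjective _ hq x
    rw [← freeMap_smul, he, he]
    exact congrArg I.cls (freeMap_smul _ r f)
  refine ⟨e, fun α f => ?_, he'⟩
  obtain ⟨t⟩ := f
  have h1 := freeMap_toScalar (K := K) J.clsHom t
  have h2 := freeMap_toScalar (K := K) (MVHom.id _) t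
  rw [← smul_incl, he']
  change α • e (incl (J.clsHom (FreeMV.mk t))) = I.cls (tmul α (FreeMV.mk t))
  rw [← h1, he, ← smul_incl]
  exact congrArg (fun y => α • I.cls y) h2

/-- Tensoring a finitely presented algebra with `[0,1] ∩ K` gives a finitely presented algebra. -/
theorem isFinitelyPresented {A : Type u} [MVAlgebra A] {n : ℕ} (q : MVHom (MVn n) A)
    (hq : ∀ a, ∃ f, q f = a) (u : MVTerm (Fin n))
    (hu : ∀ f, q f = 0 ↔ f ∈ (MVIdeal.span {FreeMV.mk u}).carrier) :
    ScalarMVAlgebra.IsFinitelyPresented K (SemisimpleTensor (UnitPart K) A) := by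
  let I := MVIdeal.span {FreeScalarMV.mk (u.toScalar K)}
  obtain ⟨e, he⟩ := (freeMap K q).exists_equiv (freeMap_surjective _ hq) I.clsHom
    I.clsHom_surjective fun f => (freeMap_eq_zero_iff q hq u hu f).trans I.cls_eq_zero.symm
  refine ⟨n, FreeScalarMV.mk (u.toScalar K), e, fun r x => ?_⟩
  obtain ⟨f, rfl⟩ := freeMap_surjective _ hq x
  rw [← freeMap_smul, he, he]
  rfl

end SemisimpleTensor

end

theorem mainTheorem6 (K : Subfield ℝ) (hK : K = ⊤ ∨ K = rationalSubfield)
    (A : Type*) [MVAlgebra A] (hA : MVAlgebra.IsFinitelyPresented A) :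
    (∀ (n : ℕ) (J : MVIdeal (MVn n)), Nonempty (MVEquiv A J.Quotient) →
      ∃ e : MVEquiv (SemisimpleTensor (UnitPart K) J.Quotient)
          (MVIdeal.span ((SemisimpleTensor.incl : MVn n → SemisimpleTensor (UnitPart K) (MVn n)) ''
            J.carrier)).Quotient,
        (∀ (α : UnitPart K) (f : MVn n),
          e (SemisimpleTensor.tmul α (J.cls f)) = MVIdeal.cls _ (SemisimpleTensor.tmul α f)) ∧
        ∀ (r : UnitPart K) (x : SemisimpleTensor (UnitPart K) J.Quotient),
          e (r • x) = r • e x) ∧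
    ScalarMVAlgebra.IsFinitelyPresented K (SemisimpleTensor (UnitPart K) A) := by
  obtain ⟨m, a, ⟨e⟩⟩ := hA
  obtain ⟨p, hp, hpa⟩ := e.exists_presentation
  obtain ⟨v⟩ := a
  refine ⟨fun n J ⟨e'⟩ => ?_, SemisimpleTensor.isFinitelyPresented p hp v hpa⟩
  obtain ⟨q, hq, hqJ⟩ := e'.exists_presentation
  -- The given `J` is an arbitrary ideal with quotient `A`; its principality is transferred from the
  -- presentation `p`.
  obtain ⟨⟨u⟩, hu⟩ := FreeMV.exists_ker_eq_span q hq p hp (FreeMV.mk v) hpa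
  exact SemisimpleTensor.exists_quotient_equiv J u fun f => (hqJ f).symm.trans (hu f)
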